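/- Let $d\ge 1$, let $D\subset\mathbb{R}^d$ be open, bounded and convex, and let $\lambda:D\to(0,\infty)$ be bounded and locally Lipschitz. For every $s\ge 1$ let $X^{(s)}$ be a Poisson point process on $sD$ with intensity function $\lambda^{(s)}(y)=\lambda(y/s)$. Write $\pi_1$ for the projection to the first coordinate and $\nu_{d-1}$ for the $(d-1)$-dimensional Hausdorff measure (normalized to agree with Lebesgue measure on hyperplanes). For a locally finite set $\varphi\subset\mathbb{R}^d$ and $y\in\varphi$, the directed spanning tree navigation $\mathcal{A}(y,\varphi)$ is the point of $\{z\in\varphi:\pi_1(z)>\pi_1(y)\}$ at minimal Euclidean distance from $y$ (the lexicographically smallest one in case of ties), and $\mathcal{A}(y,\varphi)=y$ if there is no such point. For a Borel set $I\subset\mathbb{R}^d$ put $N(\varphi,I)=\#\{y\in\varphi:[y,\mathcal{A}(y,\varphi)]\cap I\neq\emptyset\}$. Then there is a function $\lambda_{\mathcal{A}}:D\to(0,\infty)$ with the following two properties. (i) For every $0<\xi<1$, condition (D1) holds with $g(s)=s^{\xi}$ and this $\lambda_{\mathcal{A}}$. That is, $g:[1,\infty)\to[1,\infty)$ is increasing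 and unbounded with $g(s)/s$ tending monotonically to zero as $s\to\infty$, and for every $x\in D$, with $I_s(x)=\{y\in\mathbb{R}^d:|y-sx|<s^{\xi},\ \pi_1(y)=\pi_1(sx)\}$, the counts $N(X^{(s)},I_s(x))$, $s\ge 1$, are random variables (measurable up to null sets) and $$\lambda_{\mathcal{A}}(x)=\lim_{s\to\infty}\frac{\mathbb{E}\,N(X^{(s)},I_s(x))}{\nu_{d-1}(I_s(x))}.$$ (ii) For every $x\in D$, $\lambda_{\mathcal{A}}(x)$ is the intensity with which the links of the directed spanning tree on a homogeneous Poisson point process $Y$ on $\mathbb{R}^d$ of intensity $\lambda(x)$ cross a hyperplane perpendicular to the first coordinate axis: for every $c\in\mathbb{R}$ and every Borel set $B\subset\{y\in\mathbb{R}^d:\pi_1(y)=c\}$, the count $N(Y,B)$ is a random variable (measurable up to null sets) and $\mathbb{E}\,N(Y,B)=\lambda_{\mathcal{A}}(x)\,\nu_{d-1}(B)$. -/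

import Mathlib

open MeasureTheory ProbabilityTheory Filter Topology
open scoped ENNReal Pointwise

noncomputable section

namespace DirectedNetwork

/-- Random sets are functions `X : Ω → Set E`. `X` is a Poisson point process on `ℝ^d` with
(diffuse) intensity measure `Λ` if its values are locally finite sets, its counting variables are
measurable, the number of points in a Borel set `B` of finite `Λ`-measure is Poisson distributed
with mean `Λ B`, and the counts of pairwise disjoint Borel sets are independent. -/
structure IsPoissonProcess {d : ℕ} {Ω : Type*} [MeasurableSpace Ω] (P : Measure Ω)
    (X : Ω → Set (EuclideanSpace ℝ (Fin d))) (Λ : Measure (EuclideanSpace ℝ (Fin d))) : Prop where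
  locallyFinite : ∀ ω, ∀ K : Set (EuclideanSpace ℝ (Fin d)),
    Bornology.IsBounded K → (X ω ∩ K).Finite
  measurable_count : ∀ B : Set (EuclideanSpace ℝ (Fin d)), MeasurableSet B →
    Measurable fun ω => (X ω ∩ B).encard
  poisson_count : ∀ B : Set (EuclideanSpace ℝ (Fin d)), MeasurableSet B → Λ B ≠ ∞ → ∀ k : ℕ,
    P {ω | (X ω ∩ B).encard = (k : ℕ∞)} =
      ENNReal.ofReal (Real.exp (-(Λ B).toReal) * (Λ B).toReal ^ k / (k.factorial : ℝ))
  independent_counts : ∀ (n : ℕ) (B : Fin n → Set (EuclideanSpace ℝ (Fin d))),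
    (∀ i, MeasurableSet (B i)) → (∀ i j, i ≠ j → Disjoint (B i) (B j)) →
      iIndepFun (fun i ω => (X ω ∩ B i).encard) P

/-- The measure on `sD` with density `y ↦ lam (y / s)`. -/
def scaledIntensity {d : ℕ} (D : Set (EuclideanSpace ℝ (Fin d)))
    (lam : EuclideanSpace ℝ (Fin d) → ℝ) (s : ℝ) : Measure (EuclideanSpace ℝ (Fin d)) :=
  (volume.restrict (s • D)).withDensity fun y => ENNReal.ofReal (lam (s⁻¹ • y))

/-- The points of `φ` strictly to the right of `x` (in direction `e₁`) that have minimal Euclidean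
distance to `x` among all points of `φ` strictly to the right of `x`. -/
def nearestRight {d : ℕ} [NeZero d] (x : EuclideanSpace ℝ (Fin d))
    (φ : Set (EuclideanSpace ℝ (Fin d))) : Set (EuclideanSpace ℝ (Fin d)) :=
  {z | z ∈ φ ∧ x 0 < z 0 ∧ ∀ w ∈ φ, x 0 < w 0 → dist x z ≤ dist x w}

open Classical in
/-- The directed spanning tree navigation: the successor of `x` is the lexicographically smallest
element of `nearestRight x φ`; if there is no point of `φ` to the right of `x`, it is `x`. -/
def directedSpanningTree {d : ℕ} [NeZero d] (x : EuclideanSpace ℝ (Fin d))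
    (φ : Set (EuclideanSpace ℝ (Fin d))) : EuclideanSpace ℝ (Fin d) :=
  if h : ∃ z ∈ nearestRight x φ, ∀ w ∈ nearestRight x φ,
      toLex (WithLp.ofLp z) ≤ toLex (WithLp.ofLp w)
  then h.choose else x

/-- The points of `φ` whose link to their successor under the navigation `A` meets `I`. -/
def linksThrough {d : ℕ}
    (A : EuclideanSpace ℝ (Fin d) → Set (EuclideanSpace ℝ (Fin d)) → EuclideanSpace ℝ (Fin d))
    (φ I : Set (EuclideanSpace ℝ (Fin d))) : Set (EuclideanSpace ℝ (Fin d)) :=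
  {y | y ∈ φ ∧ (segment ℝ y (A y φ) ∩ I).Nonempty}

/-- The number of links through `I`, as a random variable with values in `[0, ∞]`. -/
def linkCount {d : ℕ} {Ω : Type*}
    (A : EuclideanSpace ℝ (Fin d) → Set (EuclideanSpace ℝ (Fin d)) → EuclideanSpace ℝ (Fin d))
    (X : Ω → Set (EuclideanSpace ℝ (Fin d))) (I : Set (EuclideanSpace ℝ (Fin d))) (ω : Ω) : ℝ≥0∞ :=
  ((linksThrough A (X ω) I).encard : ℝ≥0∞)

/-- The `(d-1)`-dimensional ball of radius `r` around `p` in the hyperplane through `p`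
perpendicular to `e₁`. -/
def hyperplaneBall {d : ℕ} [NeZero d] (p : EuclideanSpace ℝ (Fin d)) (r : ℝ) :
    Set (EuclideanSpace ℝ (Fin d)) :=
  Metric.ball p r ∩ {y | y 0 = p 0}

/-- Unbounded increasing functions `g : [1,∞) → [1,∞)` with `g(s)/s` decreasing to zero. -/
structure IsFluctuationFunction (g : ℝ → ℝ) : Prop where
  one_le : ∀ s, 1 ≤ s → 1 ≤ g s
  increasing : StrictMonoOn g (Set.Ici 1)
  unbounded : Tendsto g atTop atTop
  ratio_antitone : AntitoneOn (fun s => g s / s) (Set.Ici 1)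
  ratio_tendsto : Tendsto (fun s => g s / s) atTop (𝓝 0)

/-- The function `lamA` is positive on `D` and witnesses the link-density condition for the
navigation `A` on the point processes `X s` with fluctuation function `g`: for every `x ∈ D`,
`lamA x` is the limit as `s → ∞` of the expected number of links through `I_s(x)`, divided by the
`(d-1)`-dimensional Hausdorff measure of `I_s(x)`, where `I_s(x)` is the hyperplane ball of radius
`g s` around `s x`. -/
structure IsLinkDensity {d : ℕ} [NeZero d] {Ω : Type*} [MeasurableSpace Ω] (P : Measure Ω)
    (D : Set (EuclideanSpace ℝ (Fin d))) (X : ℝ → Ω → Set (EuclideanSpace ℝ (Fin d)))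
    (A : EuclideanSpace ℝ (Fin d) → Set (EuclideanSpace ℝ (Fin d)) → EuclideanSpace ℝ (Fin d))
    (g : ℝ → ℝ) (lamA : EuclideanSpace ℝ (Fin d) → ℝ) : Prop where
  pos : ∀ x ∈ D, 0 < lamA x
  aemeasurable_linkCount : ∀ x ∈ D, ∀ s : ℝ, 1 ≤ s →
    AEMeasurable (linkCount A (X s) (hyperplaneBall (s • x) (g s))) P
  tendsto : ∀ x ∈ D, Tendsto
    (fun s : ℝ => (μHE[d - 1] (hyperplaneBall (s • x) (g s)))⁻¹ *
      ∫⁻ ω, linkCount A (X s) (hyperplaneBall (s • x) (g s)) ω ∂P)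
    atTop (𝓝 (ENNReal.ofReal (lamA x)))

/-- The links of the navigation `A` on the random set `Y` cross every hyperplane perpendicular to
`e₁` with intensity `γ`: for each Borel subset `B` of such a hyperplane, the expected number of
links that hit `B` is `γ` times the `(d-1)`-dimensional Hausdorff measure of `B`. -/
def HasCrossingIntensity {d : ℕ} [NeZero d] {Ω : Type*} [MeasurableSpace Ω] (P : Measure Ω)
    (Y : Ω → Set (EuclideanSpace ℝ (Fin d)))
    (A : EuclideanSpace ℝ (Fin d) → Set (EuclideanSpace ℝ (Fin d)) → EuclideanSpace ℝ (Fin d))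
    (γ : ℝ) : Prop :=
  ∀ (c : ℝ) (B : Set (EuclideanSpace ℝ (Fin d))), B ⊆ {y | y 0 = c} → MeasurableSet B →
    AEMeasurable (linkCount A Y B) P ∧
      ∫⁻ ω, linkCount A Y B ω ∂P = ENNReal.ofReal γ * μHE[d - 1] B

end DirectedNetwork

end

namespace DirectedNetwork

/-! ### Sets of points as counting measures -/

section PointMeasure

variable {α : Type*} [MeasurableSpace α]

/-! The expected number of links through a subset B of a hyperplane is a two-point integral. Up to
null sets, (y, w) is a link exactly when w lies to the right of y and the open half ball to the
right of y, centred at y and with w on its boundary, contains no point of the process. A Mecke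
formula (`voidPairIntensity_eq_setLIntegral`) therefore turns the expectation into the integral of
exp(-Λ(half ball)) against Λ ⊗ Λ over the pairs whose segment hits B (`lintegral_linkCount`). Write
w = y + z. For fixed z with z₀ > 0, the points y with [y, y + z] hitting B form an oblique prism
over B, of volume z₀ ν(B) (`volume_segmentShadow`).

For constant intensity γ the integrand depends on z alone, so the expectation is ν(B) ∫ z₀⁺ γ²
exp(-γ κ ‖z‖^d) dz, where κ is the volume of the unit half ball. This integral is
`crossingIntensity`, and λ_A(x) is its value at γ = λ(x).

For the scaled processes, divide by ν(I_s(x)) and fix z. All half balls involved lie within s^ξ +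
2‖z‖ = o(s) of sx, where the intensity is close to λ(x) by continuity, so the contribution of z
converges to the homogeneous one (`tendsto_displacementDensity`). The delicate point is an
integrable bound uniform in s (`exists_displacementDensity_le`), since a long link may reach regions
where the intensity is small or zero. But the link crosses I_s(x), and its half ball contains a half
ball of radius c‖z‖ near the crossing point, where the intensity is at least λ(x)/2. Dominated
convergence in z finishes the proof. -/

/-- The counting measure of a set of points. -/
noncomputable def pointMeasure (φ : Set α) : Measure α :=
  Measure.sum fun y : φ => Measure.dirac (y : α)

lemma pointMeasure_apply (φ : Set α) {B : Set α} (hB : MeasurableSet B) :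
    pointMeasure φ B = ((φ ∩ B).encard : ℝ≥0∞) := by
  rw [pointMeasure, Measure.sum_apply _ hB, ← ENNReal.tsum_set_one (φ ∩ B),
    tsum_subtype φ (fun y => Measure.dirac y B), tsum_subtype (φ ∩ B) (fun _ => (1 : ℝ≥0∞))]
  refine tsum_congr fun y => ?_
  by_cases h1 : y ∈ φ <;> by_cases h2 : y ∈ B <;> simp [h1, h2, hB]

lemma pointMeasure_apply_eq_zero (φ : Set α) {B : Set α} (hB : MeasurableSet B) :
    pointMeasure φ B = 0 ↔ Disjoint φ B := by
  rw [pointMeasure_apply φ hB, ENat.toENNReal_eq_zero, Set.encard_eq_zero,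
    Set.disjoint_iff_inter_eq_empty]

lemma pointMeasure_prod {β : Type*} [MeasurableSpace β] (φ : Set α) {ψ : Set β}
    (hψ : ψ.Countable) :
    (pointMeasure φ).prod (pointMeasure ψ) = pointMeasure (φ ×ˢ ψ) := by
  have := hψ.to_subtype
  rw [pointMeasure, pointMeasure, Measure.prod_sum]
  ext S hS
  rw [pointMeasure, Measure.sum_apply _ hS, Measure.sum_apply _ hS,
    ← (Equiv.Set.prod φ ψ).tsum_eq]
  refine tsum_congr fun p => ?_
  rw [Measure.dirac_prod_dirac]
  rfl

end PointMeasure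

/-! ### The random counting measure as a kernel; measurability of void-pair counts. -/

section Poisson

variable {d : ℕ} {Ω : Type*} [MeasurableSpace Ω] {P : Measure Ω}
  {X : Ω → Set (EuclideanSpace ℝ (Fin d))} {Λ : Measure (EuclideanSpace ℝ (Fin d))}

lemma IsPoissonProcess.countable (hX : IsPoissonProcess P X Λ) (ω : Ω) : (X ω).Countable := by
  have : X ω = ⋃ n : ℕ, X ω ∩ Metric.ball 0 n := by
    rw [← Set.inter_iUnion, Metric.iUnion_ball_nat, Set.inter_univ]
  rw [this]
  exact Set.countable_iUnion fun n => (hX.locallyFinite ω _ Metric.isBounded_ball).countable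

lemma IsPoissonProcess.measurable_encard (hX : IsPoissonProcess P X Λ)
    {B : Set (EuclideanSpace ℝ (Fin d))} (hB : MeasurableSet B) :
    Measurable fun ω => ((X ω ∩ B).encard : ℝ≥0∞) :=
  (measurable_of_countable _).comp (hX.measurable_count B hB)

/-- The random counting measure of a Poisson process, as a kernel. -/
noncomputable def countKernel (hX : IsPoissonProcess P X Λ) :
    Kernel Ω (EuclideanSpace ℝ (Fin d)) where
  toFun ω := pointMeasure (X ω)
  measurable' := by
    refine Measure.measurable_of_measurable_coe _ fun B hB => ?_
    simp_rw [pointMeasure_apply _ hB]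
    exact hX.measurable_encard hB

lemma countKernel_apply (hX : IsPoissonProcess P X Λ) (ω : Ω) :
    countKernel hX ω = pointMeasure (X ω) := rfl

/-- Needed for product kernels and for measurability of kernel sections. Space is cut into bounded
shells and Ω according to the number k of points in a shell; each piece of the kernel has mass at
most k. -/
instance (hX : IsPoissonProcess P X Λ) : IsSFiniteKernel (countKernel hX) := by
  classical
  let A : ℕ → Set (EuclideanSpace ℝ (Fin d)) := disjointed fun n : ℕ => Metric.ball 0 (n : ℝ)
  have hA : ∀ n, MeasurableSet (A n) := MeasurableSet.disjointed fun n => measurableSet_ball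
  have hAU : ⋃ n, A n = Set.univ := by
    rw [iUnion_disjointed, Metric.iUnion_ball_nat]
  have hlt : ∀ n ω, (X ω ∩ A n).encard ≠ ⊤ := fun n ω => by
    have := hX.locallyFinite ω (A n) (Metric.isBounded_ball.subset (disjointed_subset _ n))
    exact this.encard_lt_top.ne
  have hs : ∀ p : ℕ × ℕ, MeasurableSet {ω | (X ω ∩ A p.1).encard = (p.2 : ℕ∞)} := fun p =>
    hX.measurable_count _ (hA p.1) (MeasurableSet.singleton _)
  let κ : ℕ × ℕ → Kernel Ω (EuclideanSpace ℝ (Fin d)) := fun p =>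
    Kernel.piecewise (hs p) ((countKernel hX).restrict (hA p.1)) 0
  have hfin : ∀ p, IsFiniteKernel (κ p) := fun p => by
    refine ⟨⟨(p.2 : ℝ≥0∞), by simp, fun ω => ?_⟩⟩
    simp only [κ, Kernel.piecewise_apply]
    split_ifs with h
    · rw [Kernel.restrict_apply, Measure.restrict_apply_univ, countKernel_apply,
        pointMeasure_apply _ (hA _)]
      rw [Set.mem_ofPred_eq] at h
      rw [h]; simp
    · simp
  have : countKernel hX = Kernel.sum κ := by
    ext ω B hB
    rw [Kernel.sum_apply' _ _ hB, ENNReal.tsum_prod (f := fun n k => κ (n, k) ω B)]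
    have h1 : ∀ n, ∑' k, κ (n, k) ω B = countKernel hX ω (B ∩ A n) := fun n => by
      obtain ⟨k, hk⟩ := ENat.ne_top_iff_exists.1 (hlt n ω)
      rw [tsum_eq_single k]
      · simp only [κ, Kernel.piecewise_apply]
        rw [if_pos (by simpa using hk.symm), Kernel.restrict_apply, Measure.restrict_apply hB]
      · intro j hj
        simp only [κ, Kernel.piecewise_apply]
        rw [if_neg]
        · simp
        · simp only [Set.mem_ofPred_eq, ← hk]
          exact_mod_cast hj.symm
    simp_rw [h1]
    rw [← measure_iUnion _ fun n => hB.inter (hA n), ← Set.inter_iUnion, hAU, Set.inter_univ]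
    intro i j hij
    exact ((disjoint_disjointed _) hij).mono Set.inter_subset_right Set.inter_subset_right
  rw [this]
  infer_instance

/-- The ordered pairs of points of `φ` such that the section of `G` over the pair contains no
point of `φ`. -/
def voidPairs {α : Type*} (φ : Set α) (G : Set ((α × α) × α)) : Set (α × α) :=
  {p | p ∈ φ ×ˢ φ ∧ Disjoint φ (Prod.mk p ⁻¹' G)}

/-- Voidness of a section is the vanishing of its counting measure. In this form measurability in ω
follows from general facts on kernels, without enumerating the points measurably. -/
lemma pointMeasure_voidPairs (hX : IsPoissonProcess P X Λ)
    {G : Set ((EuclideanSpace ℝ (Fin d) × EuclideanSpace ℝ (Fin d)) × EuclideanSpace ℝ (Fin d))}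
    (hG : MeasurableSet G)
    {S : Set (EuclideanSpace ℝ (Fin d) × EuclideanSpace ℝ (Fin d))} (hS : MeasurableSet S) (ω : Ω) :
    pointMeasure (voidPairs (X ω) G) S =
      (countKernel hX ×ₖ countKernel hX) ω
        (Prod.mk ω ⁻¹' {q : Ω × _ | q.2 ∈ S ∧ countKernel hX q.1 (Prod.mk q.2 ⁻¹' G) = 0}) := by
  have hm : MeasurableSet {p | countKernel hX ω (Prod.mk p ⁻¹' G) = 0} :=
    (measurable_measure_prodMk_left hG) (measurableSet_singleton 0)
  rw [Kernel.prod_apply, countKernel_apply, pointMeasure_prod _ (hX.countable ω),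
    pointMeasure_apply _ hS]
  change _ = pointMeasure _ (S ∩ {p | countKernel hX ω (Prod.mk p ⁻¹' G) = 0})
  rw [pointMeasure_apply _ (hS.inter hm)]
  congr 2
  ext p
  simp only [voidPairs, Set.mem_inter_iff, Set.mem_ofPred_eq, countKernel_apply,
    pointMeasure_apply_eq_zero _ (measurable_prodMk_left hG)]
  tauto

lemma measurable_pointMeasure_voidPairs (hX : IsPoissonProcess P X Λ)
    {G : Set ((EuclideanSpace ℝ (Fin d) × EuclideanSpace ℝ (Fin d)) × EuclideanSpace ℝ (Fin d))}
    (hG : MeasurableSet G) :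
    Measurable fun ω => pointMeasure (voidPairs (X ω) G) := by
  refine Measure.measurable_of_measurable_coe _ fun S hS => ?_
  simp_rw [pointMeasure_voidPairs hX hG hS]
  refine Kernel.measurable_kernel_prodMk_left ?_
  refine (measurable_snd hS).inter ?_
  have h1 : Measurable fun q : Ω × (EuclideanSpace ℝ (Fin d) × EuclideanSpace ℝ (Fin d)) =>
      Kernel.prodMkRight (EuclideanSpace ℝ (Fin d) × EuclideanSpace ℝ (Fin d)) (countKernel hX) q
        (Prod.mk q ⁻¹' {r : (Ω × (EuclideanSpace ℝ (Fin d) × EuclideanSpace ℝ (Fin d))) ×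
          EuclideanSpace ℝ (Fin d) | (r.1.2, r.2) ∈ G}) :=
    Kernel.measurable_kernel_prodMk_left
      ((measurable_fst.snd.prodMk measurable_snd) hG)
  exact h1 (measurableSet_singleton 0)

lemma measurableSet_disjoint (hX : IsPoissonProcess P X Λ)
    {C : Set (EuclideanSpace ℝ (Fin d))} (hC : MeasurableSet C) :
    MeasurableSet {ω | Disjoint (X ω) C} := by
  have : {ω | Disjoint (X ω) C} = (fun ω => (X ω ∩ C).encard) ⁻¹' {0} := by
    ext ω
    simp [Set.disjoint_iff_inter_eq_empty]
  rw [this]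
  exact hX.measurable_count C hC (MeasurableSet.singleton _)

/-- The intensity measure of the pairs of points of the process whose section of `G` is void. -/
noncomputable def voidPairIntensity (P : Measure Ω) (X : Ω → Set (EuclideanSpace ℝ (Fin d)))
    (G : Set ((EuclideanSpace ℝ (Fin d) × EuclideanSpace ℝ (Fin d)) × EuclideanSpace ℝ (Fin d))) :
    Measure (EuclideanSpace ℝ (Fin d) × EuclideanSpace ℝ (Fin d)) :=
  P.bind fun ω => pointMeasure (voidPairs (X ω) G)

lemma voidPairIntensity_apply (hX : IsPoissonProcess P X Λ)
    {G : Set ((EuclideanSpace ℝ (Fin d) × EuclideanSpace ℝ (Fin d)) × EuclideanSpace ℝ (Fin d))}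
    (hG : MeasurableSet G)
    {S : Set (EuclideanSpace ℝ (Fin d) × EuclideanSpace ℝ (Fin d))} (hS : MeasurableSet S) :
    voidPairIntensity P X G S = ∫⁻ ω, pointMeasure (voidPairs (X ω) G) S ∂P :=
  Measure.bind_apply hS (measurable_pointMeasure_voidPairs hX hG).aemeasurable

/-! ### First moments and independence -/

lemma tsum_natCast_mul_poisson {r : ℝ} (hr : 0 ≤ r) :
    ∑' k : ℕ, (k : ℝ≥0∞) * ENNReal.ofReal (Real.exp (-r) * r ^ k / (k.factorial : ℝ)) =
      ENNReal.ofReal r := by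
  rw [tsum_eq_zero_add' ENNReal.summable]
  have h1 : ∀ k : ℕ, ((k + 1 : ℕ) : ℝ≥0∞) *
      ENNReal.ofReal (Real.exp (-r) * r ^ (k + 1) / ((k + 1).factorial : ℝ)) =
      ENNReal.ofReal r * ENNReal.ofReal (Real.exp (-r) * r ^ k / (k.factorial : ℝ)) := fun k => by
    rw [← ENNReal.ofReal_natCast, ← ENNReal.ofReal_mul (by positivity), ← ENNReal.ofReal_mul hr]
    congr 1
    rw [Nat.factorial_succ]
    push_cast
    field_simp
    ring
  simp_rw [h1]
  have h2 : HasSum (fun k : ℕ => Real.exp (-r) * r ^ k / (k.factorial : ℝ)) 1 :=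
    hasSum_one_poissonMeasure ⟨r, hr⟩
  have h3 : ∑' k : ℕ, ENNReal.ofReal (Real.exp (-r) * r ^ k / (k.factorial : ℝ)) = 1 := by
    rw [← ENNReal.ofReal_tsum_of_nonneg (fun k => by positivity) h2.summable]
    rw [h2.tsum_eq, ENNReal.ofReal_one]
  rw [ENNReal.tsum_mul_left, h3]
  simp

/-- Boundedness of A and local finiteness exclude the count ⊤, so the mean is the Poisson series
over finite k. -/
lemma IsPoissonProcess.lintegral_encard (hX : IsPoissonProcess P X Λ)
    {A : Set (EuclideanSpace ℝ (Fin d))} (hA : MeasurableSet A) (hAb : Bornology.IsBounded A)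
    (hΛ : Λ A ≠ ∞) : ∫⁻ ω, ((X ω ∩ A).encard : ℝ≥0∞) ∂P = Λ A := by
  have hm := hX.measurable_count A hA
  have h1 : ∀ ω, ((X ω ∩ A).encard : ℝ≥0∞) =
      ∑' k : ℕ, (k : ℝ≥0∞) * Set.indicator {ω | (X ω ∩ A).encard = (k : ℕ∞)} 1 ω := fun ω => by
    obtain ⟨k, hk⟩ := ENat.ne_top_iff_exists.1 (hX.locallyFinite ω A hAb).encard_lt_top.ne
    rw [tsum_eq_single k]
    · rw [Set.indicator_of_mem (by exact hk.symm), ← hk]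
      simp
    · intro j hj
      rw [Set.indicator_of_notMem, mul_zero]
      simp only [Set.mem_ofPred_eq, ← hk]
      exact_mod_cast hj.symm
  have hs : ∀ k : ℕ, MeasurableSet {ω | (X ω ∩ A).encard = (k : ℕ∞)} := fun k =>
    hm (MeasurableSet.singleton _)
  simp_rw [h1]
  rw [lintegral_tsum fun k => ((measurable_one.indicator (hs k)).const_mul _).aemeasurable]
  have h2 : ∀ k : ℕ, ∫⁻ ω, (k : ℝ≥0∞) * Set.indicator {ω | (X ω ∩ A).encard = (k : ℕ∞)} 1 ω ∂P =
      (k : ℝ≥0∞) * ENNReal.ofReal (Real.exp (-(Λ A).toReal) * (Λ A).toReal ^ k /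
        (k.factorial : ℝ)) := fun k => by
    rw [lintegral_const_mul _ (measurable_one.indicator (hs k)), lintegral_indicator_one (hs k),
      hX.poisson_count A hA hΛ]
  simp_rw [h2]
  rw [tsum_natCast_mul_poisson ENNReal.toReal_nonneg, ENNReal.ofReal_toReal hΛ]

lemma IsPoissonProcess.measure_disjoint (hX : IsPoissonProcess P X Λ)
    {C : Set (EuclideanSpace ℝ (Fin d))} (hC : MeasurableSet C) (hΛ : Λ C ≠ ∞) :
    P {ω | Disjoint (X ω) C} = ENNReal.ofReal (Real.exp (-(Λ C).toReal)) := by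
  have := hX.poisson_count C hC hΛ 0
  simpa [Set.disjoint_iff_inter_eq_empty] using this

lemma IsPoissonProcess.lintegral_void_mul_mul (hX : IsPoissonProcess P X Λ)
    {A A' C : Set (EuclideanSpace ℝ (Fin d))} (hA : MeasurableSet A) (hA' : MeasurableSet A')
    (hC : MeasurableSet C) (hAA' : Disjoint A A') (hAC : Disjoint A C) (hAC' : Disjoint A' C)
    (hb : Bornology.IsBounded A) (hb' : Bornology.IsBounded A') (hΛ : Λ A ≠ ∞) (hΛ' : Λ A' ≠ ∞) :
    ∫⁻ ω, {ω | Disjoint (X ω) C}.indicator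
      (fun ω => ((X ω ∩ A).encard : ℝ≥0∞) * ((X ω ∩ A').encard : ℝ≥0∞)) ω ∂P =
      P {ω | Disjoint (X ω) C} * (Λ A * Λ A') := by
  classical
  have hind := hX.independent_counts 3 ![C, A, A']
    (by intro i; fin_cases i <;> simpa)
    (by intro i j hij
        fin_cases i <;> fin_cases j <;>
          simp_all [disjoint_comm])
  -- The integrand is a product of functions of three independent counts: the indicator of zero for
  -- C, the identity for A and A'.
  let g : Fin 3 → ℕ∞ → ℝ≥0∞ := ![fun k => if k = 0 then 1 else 0, fun k => k, fun k => k]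
  have hg := hind.comp g fun i => measurable_of_countable _
  have := lintegral_prod_eq_prod_lintegral_of_indepFun Finset.univ _ hg fun i =>
    (measurable_of_countable _).comp
      (hX.measurable_count _ (by fin_cases i <;> simpa))
  simp only [Fin.prod_univ_three, g, Matrix.cons_val_zero, Matrix.cons_val_one,
    Function.comp_apply, Matrix.cons_val] at this
  rw [hX.lintegral_encard hA hb hΛ, hX.lintegral_encard hA' hb' hΛ'] at this
  have hind0 : ∀ ω, (if (X ω ∩ C).encard = 0 then (1 : ℝ≥0∞) else 0) =
      {ω | Disjoint (X ω) C}.indicator 1 ω := fun ω => by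
    simp [Set.indicator_apply, Set.disjoint_iff_inter_eq_empty]
  simp_rw [hind0] at this
  rw [lintegral_indicator_one (measurableSet_disjoint hX hC), mul_assoc] at this
  rw [← this]
  refine lintegral_congr fun ω => ?_
  by_cases h : ω ∈ {ω | Disjoint (X ω) C} <;> simp [h]

end Poisson
end DirectedNetwork

namespace DirectedNetwork

/-! ### The two-point Mecke formula for void functionals, from independence of counts. -/

section Mecke

variable {d : ℕ} {Ω : Type*} [MeasurableSpace Ω] {P : Measure Ω}
  {X : Ω → Set (EuclideanSpace ℝ (Fin d))} {Λ : Measure (EuclideanSpace ℝ (Fin d))}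

lemma voidPairs_anti {α : Type*} (φ : Set α) {G G' : Set ((α × α) × α)} (h : G ⊆ G') :
    voidPairs φ G' ⊆ voidPairs φ G :=
  fun _ hp => ⟨hp.1, hp.2.mono_right (Set.preimage_mono h)⟩

lemma pointMeasure_mono {α : Type*} [MeasurableSpace α] {φ ψ : Set α} (h : φ ⊆ ψ) {S : Set α}
    (hS : MeasurableSet S) : pointMeasure φ S ≤ pointMeasure ψ S := by
  rw [pointMeasure_apply _ hS, pointMeasure_apply _ hS]
  exact ENat.toENNReal_le.2 (Set.encard_le_encard (Set.inter_subset_inter_left _ h))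

lemma voidPairIntensity_congr (hX : IsPoissonProcess P X Λ)
    {G G' : Set ((EuclideanSpace ℝ (Fin d) × EuclideanSpace ℝ (Fin d)) × EuclideanSpace ℝ (Fin d))}
    (hG : MeasurableSet G) (hG' : MeasurableSet G')
    {S : Set (EuclideanSpace ℝ (Fin d) × EuclideanSpace ℝ (Fin d))} (hS : MeasurableSet S)
    (h : ∀ p ∈ S, Prod.mk p ⁻¹' G = Prod.mk p ⁻¹' G') :
    voidPairIntensity P X G S = voidPairIntensity P X G' S := by
  rw [voidPairIntensity_apply hX hG hS, voidPairIntensity_apply hX hG' hS]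
  refine lintegral_congr fun ω => ?_
  rw [pointMeasure_apply _ hS, pointMeasure_apply _ hS]
  congr 2
  ext p
  simp only [voidPairs, Set.mem_inter_iff, Set.mem_ofPred_eq]
  refine ⟨fun hp => ⟨⟨hp.1.1, ?_⟩, hp.2⟩, fun hp => ⟨⟨hp.1.1, ?_⟩, hp.2⟩⟩
  · rw [← h p hp.2]; exact hp.1.2
  · rw [h p hp.2]; exact hp.1.2

/-- Two-point Campbell formula on disjoint sets, with a fixed void set. -/
lemma voidPairIntensity_univ_prod_restrict (hX : IsPoissonProcess P X Λ) [SFinite Λ]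
    [IsProbabilityMeasure P]
    {A A' C : Set (EuclideanSpace ℝ (Fin d))} (hA : MeasurableSet A) (hA' : MeasurableSet A')
    (hC : MeasurableSet C) (hAA' : Disjoint A A') (hAC : Disjoint A C) (hAC' : Disjoint A' C)
    (hb : Bornology.IsBounded A) (hb' : Bornology.IsBounded A') (hΛ : Λ A ≠ ∞) (hΛ' : Λ A' ≠ ∞) :
    (voidPairIntensity P X (Set.univ ×ˢ C)).restrict (A ×ˢ A') =
      P {ω | Disjoint (X ω) C} • (Λ.prod Λ).restrict (A ×ˢ A') := by
  have hG : MeasurableSet ((Set.univ : Set (EuclideanSpace ℝ (Fin d) × EuclideanSpace ℝ (Fin d)))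
    ×ˢ C) := MeasurableSet.univ.prod hC
  have key : ∀ s t, MeasurableSet s → MeasurableSet t → s ⊆ A → t ⊆ A' →
      voidPairIntensity P X (Set.univ ×ˢ C) (s ×ˢ t) =
        P {ω | Disjoint (X ω) C} * (Λ s * Λ t) := by
    intro s t hs ht hsA htA
    rw [voidPairIntensity_apply hX hG (hs.prod ht), ← hX.lintegral_void_mul_mul hs ht hC
      (hAA'.mono hsA htA) (hAC.mono_left hsA) (hAC'.mono_left htA) (hb.subset hsA)
      (hb'.subset htA) (measure_ne_top_of_subset hsA hΛ) (measure_ne_top_of_subset htA hΛ')]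
    refine lintegral_congr fun ω => ?_
    rw [pointMeasure_apply _ (hs.prod ht)]
    have hsec : ∀ p : EuclideanSpace ℝ (Fin d) × EuclideanSpace ℝ (Fin d),
        Prod.mk p ⁻¹' (Set.univ ×ˢ C) = C := fun p => by ext; simp
    by_cases h : Disjoint (X ω) C
    · rw [Set.indicator_of_mem (by exact h)]
      have : voidPairs (X ω) (Set.univ ×ˢ C) ∩ s ×ˢ t = (X ω ∩ s) ×ˢ (X ω ∩ t) := by
        ext p
        simp only [voidPairs, hsec, Set.mem_inter_iff, Set.mem_ofPred_eq, Set.mem_prod, h]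
        tauto
      rw [this, Set.encard_prod, ENat.toENNReal_mul]
    · rw [Set.indicator_of_notMem (by exact h)]
      have : voidPairs (X ω) (Set.univ ×ˢ C) ∩ s ×ˢ t = ∅ := by
        ext p
        simp [voidPairs, hsec, h]
      rw [this]; simp
  have : IsFiniteMeasure ((voidPairIntensity P X (Set.univ ×ˢ C)).restrict (A ×ˢ A')) := by
    refine ⟨?_⟩
    rw [Measure.restrict_apply_univ, key A A' hA hA' subset_rfl subset_rfl]
    exact ENNReal.mul_lt_top (measure_lt_top _ _) (ENNReal.mul_lt_top hΛ.lt_top hΛ'.lt_top)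
  refine Measure.ext_prod fun {s t} hs ht => ?_
  rw [Measure.restrict_apply (hs.prod ht), Measure.smul_apply,
    Measure.restrict_apply (hs.prod ht), Set.prod_inter_prod,
    key _ _ (hs.inter hA) (ht.inter hA') Set.inter_subset_right Set.inter_subset_right,
    Measure.prod_prod, smul_eq_mul]

/-- A and A' may meet C, but S lives on (A \ C) × (A' \ C), where the three counts involved are
independent. -/
lemma voidPairIntensity_univ_prod (hX : IsPoissonProcess P X Λ) [SFinite Λ]
    [IsProbabilityMeasure P]
    {A A' C : Set (EuclideanSpace ℝ (Fin d))} (hA : MeasurableSet A) (hA' : MeasurableSet A')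
    (hC : MeasurableSet C) (hAA' : Disjoint A A')
    (hb : Bornology.IsBounded A) (hb' : Bornology.IsBounded A') (hΛ : Λ A ≠ ∞) (hΛ' : Λ A' ≠ ∞)
    {S : Set (EuclideanSpace ℝ (Fin d) × EuclideanSpace ℝ (Fin d))} (hS : MeasurableSet S)
    (hSA : S ⊆ A ×ˢ A') (hSC : ∀ p ∈ S, p.1 ∉ C ∧ p.2 ∉ C) :
    voidPairIntensity P X (Set.univ ×ˢ C) S = P {ω | Disjoint (X ω) C} * (Λ.prod Λ) S := by
  have h := voidPairIntensity_univ_prod_restrict hX (hA.diff hC) (hA'.diff hC) hC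
    (hAA'.mono Set.sdiff_subset Set.sdiff_subset) Set.disjoint_sdiff_left Set.disjoint_sdiff_left
    (hb.subset Set.sdiff_subset) (hb'.subset Set.sdiff_subset)
    (measure_ne_top_of_subset Set.sdiff_subset hΛ) (measure_ne_top_of_subset Set.sdiff_subset hΛ')
  have hsub : S ⊆ (A \ C) ×ˢ (A' \ C) := fun p hp =>
    ⟨⟨(hSA hp).1, (hSC p hp).1⟩, ⟨(hSA hp).2, (hSC p hp).2⟩⟩
  have := congrArg (fun m => m S) h
  simpa [Measure.restrict_apply hS, Set.inter_eq_left.2 hsub] using this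

/-- Induction on the number of rectangles, splitting S along `R n`: over `S ∩ R n` the last
rectangle contributes `U n` to every section, over `S \ R n` it contributes nothing. The statement
is general in C because C absorbs `U n` in the first case. -/
lemma voidPairIntensity_finite_union (hX : IsPoissonProcess P X Λ) [SFinite Λ]
    [IsProbabilityMeasure P]
    {A A' : Set (EuclideanSpace ℝ (Fin d))} (hA : MeasurableSet A) (hA' : MeasurableSet A')
    (hAA' : Disjoint A A')
    (hb : Bornology.IsBounded A) (hb' : Bornology.IsBounded A') (hΛ : Λ A ≠ ∞) (hΛ' : Λ A' ≠ ∞)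
    {R : ℕ → Set (EuclideanSpace ℝ (Fin d) × EuclideanSpace ℝ (Fin d))}
    (hR : ∀ k, MeasurableSet (R k)) {U : ℕ → Set (EuclideanSpace ℝ (Fin d))}
    (hU : ∀ k, MeasurableSet (U k)) (n : ℕ) :
    ∀ (C : Set (EuclideanSpace ℝ (Fin d))) (_ : MeasurableSet C)
      (S : Set (EuclideanSpace ℝ (Fin d) × EuclideanSpace ℝ (Fin d))) (_ : MeasurableSet S)
      (_ : S ⊆ A ×ˢ A') (_ : ∀ p ∈ S, p.1 ∉ C ∧ p.2 ∉ C)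
      (_ : ∀ p ∈ S, ∀ k < n, p ∈ R k → p.1 ∉ U k ∧ p.2 ∉ U k),
      voidPairIntensity P X (Set.univ ×ˢ C ∪ ⋃ k ∈ Finset.range n, R k ×ˢ U k) S =
        ∫⁻ p in S, P {ω | Disjoint (X ω)
          (Prod.mk p ⁻¹' (Set.univ ×ˢ C ∪ ⋃ k ∈ Finset.range n, R k ×ˢ U k))} ∂(Λ.prod Λ) := by
  have hmeas : ∀ (m : ℕ) (C : Set (EuclideanSpace ℝ (Fin d))), MeasurableSet C →
      MeasurableSet (Set.univ ×ˢ C ∪ ⋃ k ∈ Finset.range m, R k ×ˢ U k) := fun m C hC =>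
    (MeasurableSet.univ.prod hC).union
      (Finset.measurableSet_biUnion _ fun k _ => (hR k).prod (hU k))
  induction n with
  | zero =>
    intro C hC S hS hSA hSC _
    have hsec : ∀ p : EuclideanSpace ℝ (Fin d) × EuclideanSpace ℝ (Fin d),
        Prod.mk p ⁻¹' (Set.univ ×ˢ C) = C := fun p => by ext; simp
    simp only [Finset.range_zero, Finset.notMem_empty, Set.iUnion_of_empty, Set.iUnion_empty,
      Set.union_empty, hsec, lintegral_const, Measure.restrict_apply_univ]
    exact voidPairIntensity_univ_prod hX hA hA' hC hAA' hb hb' hΛ hΛ' hS hSA hSC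
  | succ n ih =>
    intro C hC S hS hSA hSC hSU
    rw [← measure_inter_add_sdiff S (hR n), ← lintegral_inter_add_sdiff _ S (hR n)]
    have h1 : ∀ p ∈ S ∩ R n,
        Prod.mk p ⁻¹' (Set.univ ×ˢ C ∪ ⋃ k ∈ Finset.range (n + 1), R k ×ˢ U k) =
        Prod.mk p ⁻¹' (Set.univ ×ˢ (C ∪ U n) ∪ ⋃ k ∈ Finset.range n, R k ×ˢ U k) := by
      intro p hp
      ext v
      have hp2 := hp.2
      simp only [Finset.range_add_one, Finset.set_biUnion_insert, Set.mem_preimage, Set.mem_union,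
        Set.mem_prod, Set.mem_univ, true_and, hp2]
      tauto
    have h2 : ∀ p ∈ S \ R n,
        Prod.mk p ⁻¹' (Set.univ ×ˢ C ∪ ⋃ k ∈ Finset.range (n + 1), R k ×ˢ U k) =
        Prod.mk p ⁻¹' (Set.univ ×ˢ C ∪ ⋃ k ∈ Finset.range n, R k ×ˢ U k) := by
      intro p hp
      ext v
      have hp2 := hp.2
      simp only [Finset.range_add_one, Finset.set_biUnion_insert, Set.mem_preimage, Set.mem_union,
        Set.mem_prod, Set.mem_univ, true_and, hp2]
      tauto
    congr 1
    · rw [voidPairIntensity_congr hX (hmeas _ _ hC) (hmeas n _ (hC.union (hU n)))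
        (hS.inter (hR n)) h1, ih _ (hC.union (hU n)) _ (hS.inter (hR n))
        (Set.inter_subset_left.trans hSA) ?_ ?_]
      · exact setLIntegral_congr_fun (hS.inter (hR n)) fun p hp => by simp only [h1 p hp]
      · intro p hp
        have h3 := hSC p hp.1
        have h4 := hSU p hp.1 n (Nat.lt_succ_self n) hp.2
        simp only [Set.mem_union]
        tauto
      · exact fun p hp k hk => hSU p hp.1 k (hk.trans (Nat.lt_succ_self n))
    · rw [voidPairIntensity_congr hX (hmeas _ _ hC) (hmeas n _ hC)
        (hS.diff (hR n)) h2, ih _ hC _ (hS.diff (hR n))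
        (Set.sdiff_subset.trans hSA) ?_ ?_]
      · exact setLIntegral_congr_fun (hS.diff (hR n)) fun p hp => by simp only [h2 p hp]
      · exact fun p hp => hSC p hp.1
      · exact fun p hp k hk => hSU p hp.1 k (hk.trans (Nat.lt_succ_self n))

lemma measurable_measure_disjoint (hX : IsPoissonProcess P X Λ) [IsProbabilityMeasure P]
    {α : Type*} [MeasurableSpace α]
    {G : Set (α × EuclideanSpace ℝ (Fin d))} (hG : MeasurableSet G) :
    Measurable fun p => P {ω | Disjoint (X ω) (Prod.mk p ⁻¹' G)} := by
  have h1 : Measurable fun q : Ω × α =>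
      Kernel.prodMkRight α (countKernel hX) q
        (Prod.mk q ⁻¹' {r : (Ω × α) × EuclideanSpace ℝ (Fin d) | (r.1.2, r.2) ∈ G}) :=
    Kernel.measurable_kernel_prodMk_left ((measurable_fst.snd.prodMk measurable_snd) hG)
  have h2 := measurable_measure_prodMk_right (μ := P) (h1 (measurableSet_singleton 0))
  convert h2 using 3 with p
  ext ω
  simp only [Set.mem_preimage, Set.mem_ofPred_eq, Kernel.prodMkRight_apply, countKernel_apply,
    Set.mem_singleton_iff]
  exact (pointMeasure_apply_eq_zero _ (measurable_prodMk_left hG)).symm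

lemma exists_iUnion_prod_of_isOpen {α β : Type*} [TopologicalSpace α] [TopologicalSpace β]
    [SecondCountableTopology α] [SecondCountableTopology β] {G : Set (α × β)} (hG : IsOpen G) :
    ∃ (R : ℕ → Set α) (U : ℕ → Set β), (∀ k, IsOpen (R k)) ∧ (∀ k, IsOpen (U k)) ∧
      G = ⋃ k, R k ×ˢ U k := by
  have hB := (TopologicalSpace.isBasis_countableBasis α).prod
    (TopologicalSpace.isBasis_countableBasis β)
  obtain ⟨S, hS, rfl⟩ := hB.open_eq_sUnion hG
  -- The empty rectangle makes the family nonempty, so that ℕ enumerates it.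
  have hc : (insert ((∅ : Set α) ×ˢ (∅ : Set β)) S).Countable :=
    (((TopologicalSpace.countable_countableBasis α).image2
      (TopologicalSpace.countable_countableBasis β) _).mono hS).insert _
  obtain ⟨f, hf⟩ := hc.exists_eq_range (Set.insert_nonempty _ _)
  have hex : ∀ k, ∃ (r : Set α) (u : Set β), IsOpen r ∧ IsOpen u ∧ f k = r ×ˢ u := by
    intro k
    have hk : f k ∈ insert ((∅ : Set α) ×ˢ (∅ : Set β)) S := hf ▸ Set.mem_range_self k
    rcases hk with hk | hk
    · exact ⟨∅, ∅, isOpen_empty, isOpen_empty, hk⟩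
    · obtain ⟨r, hr, u, hu, h⟩ := hS hk
      exact ⟨r, u, TopologicalSpace.isOpen_of_mem_countableBasis hr,
        TopologicalSpace.isOpen_of_mem_countableBasis hu, h.symm⟩
  choose R U hR hU hRU using hex
  refine ⟨R, U, hR, hU, ?_⟩
  have : ⋃ k, R k ×ˢ U k = ⋃₀ Set.range f := by
    rw [Set.sUnion_range]
    simp_rw [hRU]
  rw [this, ← hf, Set.sUnion_insert]
  simp

/-- G is exhausted by finite unions of open rectangles. For each ω only finitely many pairs of
points lie in S, and for each of them voidness of the approximating section eventually agrees with
voidness of the section of G. Both sides converge by domination. -/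
lemma voidPairIntensity_of_isOpen (hX : IsPoissonProcess P X Λ) [SFinite Λ]
    [IsProbabilityMeasure P]
    {A A' : Set (EuclideanSpace ℝ (Fin d))} (hA : MeasurableSet A) (hA' : MeasurableSet A')
    (hAA' : Disjoint A A')
    (hb : Bornology.IsBounded A) (hb' : Bornology.IsBounded A') (hΛ : Λ A ≠ ∞) (hΛ' : Λ A' ≠ ∞)
    {G : Set ((EuclideanSpace ℝ (Fin d) × EuclideanSpace ℝ (Fin d)) × EuclideanSpace ℝ (Fin d))}
    (hG : IsOpen G)
    {S : Set (EuclideanSpace ℝ (Fin d) × EuclideanSpace ℝ (Fin d))} (hS : MeasurableSet S)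
    (hSA : S ⊆ A ×ˢ A') (hSG : ∀ p ∈ S, (p, p.1) ∉ G ∧ (p, p.2) ∉ G) :
    voidPairIntensity P X G S =
      ∫⁻ p in S, P {ω | Disjoint (X ω) (Prod.mk p ⁻¹' G)} ∂(Λ.prod Λ) := by
  obtain ⟨R, U, hR, hU, rfl⟩ := exists_iUnion_prod_of_isOpen hG
  set G : Set ((EuclideanSpace ℝ (Fin d) × EuclideanSpace ℝ (Fin d)) × EuclideanSpace ℝ (Fin d)) :=
    ⋃ k, R k ×ˢ U k with hGdef
  let Gn : ℕ → Set ((EuclideanSpace ℝ (Fin d) × EuclideanSpace ℝ (Fin d)) ×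
      EuclideanSpace ℝ (Fin d)) := fun n =>
    Set.univ ×ˢ (∅ : Set (EuclideanSpace ℝ (Fin d))) ∪ ⋃ k ∈ Finset.range n, R k ×ˢ U k
  have hGn : ∀ n, MeasurableSet (Gn n) := fun n =>
    (MeasurableSet.univ.prod MeasurableSet.empty).union (Finset.measurableSet_biUnion _
      fun k _ => (hR k).measurableSet.prod (hU k).measurableSet)
  have hGnG : ∀ n, Gn n ⊆ G := fun n => by
    simp only [Gn, Set.prod_empty, Set.empty_union]
    exact Set.iUnion₂_subset fun k _ => Set.subset_iUnion (fun k => R k ×ˢ U k) k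
  have hmem : ∀ x ∈ G, ∀ᶠ n in atTop, x ∈ Gn n := fun x hx => by
    obtain ⟨k, hk⟩ := Set.mem_iUnion.1 hx
    filter_upwards [eventually_gt_atTop k] with n hn
    exact Or.inr (Set.mem_biUnion (Finset.mem_coe.2 (Finset.mem_range.2 hn)) hk)
  have hdis : ∀ (φ : Set (EuclideanSpace ℝ (Fin d))) p, ∀ᶠ n in atTop,
      (Disjoint φ (Prod.mk p ⁻¹' Gn n) ↔ Disjoint φ (Prod.mk p ⁻¹' G)) := fun φ p => by
    by_cases h : Disjoint φ (Prod.mk p ⁻¹' G)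
    · exact Eventually.of_forall fun n =>
        ⟨fun _ => h, fun _ => h.mono_right (Set.preimage_mono (hGnG n))⟩
    · obtain ⟨v, hv, hvG⟩ := Set.not_disjoint_iff.1 h
      filter_upwards [hmem _ hvG] with n hn
      exact ⟨fun h' => absurd h' (Set.not_disjoint_iff.2 ⟨v, hv, hn⟩), fun h' => absurd h' h⟩
  have heq : ∀ n, voidPairIntensity P X (Gn n) S =
      ∫⁻ p in S, P {ω | Disjoint (X ω) (Prod.mk p ⁻¹' Gn n)} ∂(Λ.prod Λ) := fun n =>
    voidPairIntensity_finite_union hX hA hA' hAA' hb hb' hΛ hΛ' (fun k => (hR k).measurableSet)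
      (fun k => (hU k).measurableSet) n ∅ MeasurableSet.empty S hS hSA (fun p _ => by simp)
      fun p hp k hk hpk => ⟨fun h => (hSG p hp).1 (Set.mem_iUnion.2 ⟨k, hpk, h⟩),
        fun h => (hSG p hp).2 (Set.mem_iUnion.2 ⟨k, hpk, h⟩)⟩
  have hfinS : (Λ.prod Λ) S ≠ ∞ := by
    refine measure_ne_top_of_subset hSA ?_
    rw [Measure.prod_prod]
    exact ENNReal.mul_ne_top hΛ hΛ'
  have hL : Tendsto (fun n => voidPairIntensity P X (Gn n) S) atTop
      (𝓝 (voidPairIntensity P X G S)) := by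
    simp_rw [voidPairIntensity_apply hX (hGn _) hS, voidPairIntensity_apply hX hG.measurableSet hS]
    refine tendsto_lintegral_of_dominated_convergence
      -- `Gn 0` is empty, so the dominating count carries no void condition; its mean is at most (Λ
      -- ⊗ Λ)(S).
      (fun ω => pointMeasure (voidPairs (X ω) (Gn 0)) S)
      (fun n => (Measure.measurable_coe hS).comp (measurable_pointMeasure_voidPairs hX (hGn n)))
      (fun n => Eventually.of_forall fun ω => ?_) ?_ (Eventually.of_forall fun ω => ?_)
    · refine pointMeasure_mono (voidPairs_anti _ ?_) hS
      simp [Gn]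
    · rw [← voidPairIntensity_apply hX (hGn 0) hS, heq 0]
      refine ((setLIntegral_mono measurable_const fun p _ => prob_le_one).trans_lt ?_).ne
      simpa using hfinS.lt_top
    · have hfin : (X ω ×ˢ X ω ∩ S).Finite := by
        refine ((hX.locallyFinite ω A hb).prod (hX.locallyFinite ω A' hb')).subset ?_
        intro p hp
        exact ⟨⟨hp.1.1, (hSA hp.2).1⟩, ⟨hp.1.2, (hSA hp.2).2⟩⟩
      refine tendsto_const_nhds.congr' ?_
      filter_upwards [(eventually_all_finite hfin).2 fun p _ => hdis (X ω) p] with n hn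
      rw [pointMeasure_apply _ hS, pointMeasure_apply _ hS]
      congr 2
      ext p
      simp only [voidPairs, Set.mem_inter_iff, Set.mem_ofPred_eq]
      constructor
      · exact fun hp => ⟨⟨hp.1.1, (hn p ⟨hp.1.1, hp.2⟩).2 hp.1.2⟩, hp.2⟩
      · exact fun hp => ⟨⟨hp.1.1, (hn p ⟨hp.1.1, hp.2⟩).1 hp.1.2⟩, hp.2⟩
  have hRt : Tendsto (fun n => ∫⁻ p in S, P {ω | Disjoint (X ω) (Prod.mk p ⁻¹' Gn n)} ∂(Λ.prod Λ))
      atTop (𝓝 (∫⁻ p in S, P {ω | Disjoint (X ω) (Prod.mk p ⁻¹' G)} ∂(Λ.prod Λ))) := by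
    refine tendsto_lintegral_of_dominated_convergence (fun _ => 1)
      (fun n => measurable_measure_disjoint hX (hGn n))
      (fun n => Eventually.of_forall fun p => prob_le_one) ?_ (Eventually.of_forall fun p => ?_)
    · simpa using hfinS
    · refine tendsto_measure_of_ae_tendsto_indicator atTop
        (measurableSet_disjoint hX (measurable_prodMk_left hG.measurableSet))
        (fun n => measurableSet_disjoint hX (measurable_prodMk_left (hGn n)))
        MeasurableSet.univ (measure_ne_top _ _) (Eventually.of_forall fun n => Set.subset_univ _)
        (Eventually.of_forall fun ω => ?_)
      exact hdis (X ω) p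
  simp_rw [← heq] at hRt
  exact tendsto_nhds_unique hL hRt

/-- Two-point Mecke formula for void functionals: for an open set `G` whose section over a pair of
points does not contain these points, the pairs `(y, w)` of points of the process with `y 0 < w 0`
whose section of `G` is void have intensity `P (X ∩ G_(y, w) = ∅)` with respect to `Λ ⊗ Λ`. -/
theorem voidPairIntensity_eq_setLIntegral [NeZero d] (hX : IsPoissonProcess P X Λ) [SFinite Λ]
    [IsProbabilityMeasure P] (hΛ : ∀ K, Bornology.IsBounded K → Λ K ≠ ∞)
    {G : Set ((EuclideanSpace ℝ (Fin d) × EuclideanSpace ℝ (Fin d)) × EuclideanSpace ℝ (Fin d))}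
    (hG : IsOpen G)
    {S : Set (EuclideanSpace ℝ (Fin d) × EuclideanSpace ℝ (Fin d))} (hS : MeasurableSet S)
    (hS0 : ∀ p ∈ S, p.1 0 < p.2 0) (hSG : ∀ p ∈ S, (p, p.1) ∉ G ∧ (p, p.2) ∉ G) :
    voidPairIntensity P X G S =
      ∫⁻ p in S, P {ω | Disjoint (X ω) (Prod.mk p ⁻¹' G)} ∂(Λ.prod Λ) := by
  -- A rational height q strictly between the first coordinates separates the two points, which
  -- gives disjoint bounded factors as the local formula requires.
  let A : ℚ × ℕ → Set (EuclideanSpace ℝ (Fin d)) := fun i => {y | y 0 < i.1} ∩ Metric.ball 0 i.2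
  let A' : ℚ × ℕ → Set (EuclideanSpace ℝ (Fin d)) := fun i =>
    {y | (i.1 : ℝ) ≤ y 0} ∩ Metric.ball 0 i.2
  have hm0 : Measurable fun y : EuclideanSpace ℝ (Fin d) => y 0 := by fun_prop
  have hA : ∀ i, MeasurableSet (A i) := fun i =>
    (hm0 measurableSet_Iio).inter measurableSet_ball
  have hA' : ∀ i, MeasurableSet (A' i) := fun i =>
    (hm0 measurableSet_Ici).inter measurableSet_ball
  have hb : ∀ i, Bornology.IsBounded (A i) := fun i =>
    Metric.isBounded_ball.subset Set.inter_subset_right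
  have hb' : ∀ i, Bornology.IsBounded (A' i) := fun i =>
    Metric.isBounded_ball.subset Set.inter_subset_right
  have hU : S = ⋃ i, S ∩ A i ×ˢ A' i := by
    rw [← Set.inter_iUnion]
    refine (Set.inter_eq_left.2 fun p hp => ?_).symm
    obtain ⟨q, hq1, hq2⟩ := exists_rat_btwn (hS0 p hp)
    obtain ⟨n, hn⟩ := exists_nat_gt (max ‖p.1‖ ‖p.2‖)
    refine Set.mem_iUnion.2 ⟨(q, n), ⟨⟨hq1, ?_⟩, ⟨hq2.le, ?_⟩⟩⟩
    · simpa using (le_max_left _ _).trans_lt hn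
    · simpa using (le_max_right _ _).trans_lt hn
  have hSm : ∀ i, MeasurableSet (S ∩ A i ×ˢ A' i) := fun i => hS.inter ((hA i).prod (hA' i))
  -- Equality of restricted measures can be checked on a countable cover, so the overlapping pieces
  -- need not be made disjoint.
  have key : (voidPairIntensity P X G).restrict S = ((Λ.prod Λ).withDensity
      fun p => P {ω | Disjoint (X ω) (Prod.mk p ⁻¹' G)}).restrict S := by
    rw [hU, Measure.restrict_iUnion_congr]
    intro i
    ext B hB
    rw [Measure.restrict_apply hB, Measure.restrict_apply hB,
      withDensity_apply _ (hB.inter (hSm i))]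
    refine voidPairIntensity_of_isOpen hX (hA i) (hA' i) ?_ (hb i) (hb' i) (hΛ _ (hb i))
      (hΛ _ (hb' i)) hG (hB.inter (hSm i)) (fun p hp => hp.2.2) (fun p hp => hSG p hp.2.1)
    rw [Set.disjoint_left]
    intro y hy hy'
    exact lt_irrefl _ (lt_of_lt_of_le (show y 0 < (i.1 : ℝ) from hy.1) hy'.1)
  have := congrArg (fun m => m S) key
  simpa [withDensity_apply _ hS] using this

end Mecke
end DirectedNetwork

namespace DirectedNetwork

/-! ### Links as void pairs, almost surely, and the expected link count. -/

section Links

variable {d : ℕ} [NeZero d]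

/-- For `ε = 0`, the section over `(y, w)` is the open half ball around `y` to the right of `y` with
`w` on its boundary. For `ε > 0` its radius is enlarged by `ε` and the point `w` is removed. -/
def nearZone (d : ℕ) [NeZero d] (ε : ℝ) :
    Set ((EuclideanSpace ℝ (Fin d) × EuclideanSpace ℝ (Fin d)) × EuclideanSpace ℝ (Fin d)) :=
  {q | q.1.1 0 < q.2 0 ∧ dist q.1.1 q.2 < dist q.1.1 q.1.2 + ε ∧ q.2 ≠ q.1.2}

lemma isOpen_nearZone (ε : ℝ) : IsOpen (nearZone d ε) := by
  have h1 : IsOpen {q : (EuclideanSpace ℝ (Fin d) × EuclideanSpace ℝ (Fin d)) ×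
      EuclideanSpace ℝ (Fin d) | q.1.1 0 < q.2 0} := isOpen_lt (by fun_prop) (by fun_prop)
  have h2 : IsOpen {q : (EuclideanSpace ℝ (Fin d) × EuclideanSpace ℝ (Fin d)) ×
      EuclideanSpace ℝ (Fin d) | dist q.1.1 q.2 < dist q.1.1 q.1.2 + ε} :=
    isOpen_lt (by fun_prop) (by fun_prop)
  have h3 : IsOpen {q : (EuclideanSpace ℝ (Fin d) × EuclideanSpace ℝ (Fin d)) ×
      EuclideanSpace ℝ (Fin d) | q.2 ≠ q.1.2} := isOpen_ne_fun (by fun_prop) (by fun_prop)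
  exact h1.inter (h2.inter h3)

lemma nearZone_mono {ε ε' : ℝ} (h : ε ≤ ε') : nearZone d ε ⊆ nearZone d ε' :=
  fun _ hq => ⟨hq.1, hq.2.1.trans_le (by gcongr), hq.2.2⟩

/-- The pairs `(y, w)` with `w` to the right of `y` such that the segment `[y, w]` hits `B`. -/
def crossingPairs (B : Set (EuclideanSpace ℝ (Fin d))) :
    Set (EuclideanSpace ℝ (Fin d) × EuclideanSpace ℝ (Fin d)) :=
  {p | p.1 0 < p.2 0 ∧ (segment ℝ p.1 p.2 ∩ B).Nonempty}

/-- The first coordinate is strictly increasing along the segment, so the hyperplane can be met at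
one parameter only. -/
lemma segment_inter_nonempty_iff {c : ℝ} {B : Set (EuclideanSpace ℝ (Fin d))}
    (hB : B ⊆ {y | y 0 = c}) {y w : EuclideanSpace ℝ (Fin d)} (h : y 0 < w 0) :
    (segment ℝ y w ∩ B).Nonempty ↔ (c - y 0) / (w 0 - y 0) ∈ Set.Icc (0 : ℝ) 1 ∧
      y + ((c - y 0) / (w 0 - y 0)) • (w - y) ∈ B := by
  have hpos : 0 < w 0 - y 0 := sub_pos.2 h
  rw [segment_eq_image']
  constructor
  · rintro ⟨_, ⟨t, ht, rfl⟩, htB⟩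
    have hc : y 0 + t * (w 0 - y 0) = c := by simpa using hB htB
    have : (c - y 0) / (w 0 - y 0) = t := by
      rw [div_eq_iff hpos.ne']; linarith
    rw [this]
    exact ⟨ht, htB⟩
  · rintro ⟨h1, h2⟩
    exact ⟨_, ⟨_, h1, rfl⟩, h2⟩

lemma measurableSet_crossingPairs {c : ℝ} {B : Set (EuclideanSpace ℝ (Fin d))}
    (hB : B ⊆ {y | y 0 = c}) (hBm : MeasurableSet B) : MeasurableSet (crossingPairs B) := by
  have hm0 : Measurable fun y : EuclideanSpace ℝ (Fin d) => y 0 := by fun_prop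
  have ht : Measurable fun p : EuclideanSpace ℝ (Fin d) × EuclideanSpace ℝ (Fin d) =>
      (c - p.1 0) / (p.2 0 - p.1 0) :=
    (measurable_const.sub (hm0.comp measurable_fst)).div
      ((hm0.comp measurable_snd).sub (hm0.comp measurable_fst))
  have : crossingPairs B = {p | p.1 0 < p.2 0} ∩
      ((fun p => (c - p.1 0) / (p.2 0 - p.1 0)) ⁻¹' Set.Icc (0 : ℝ) 1 ∩
      (fun p => p.1 + ((c - p.1 0) / (p.2 0 - p.1 0)) • (p.2 - p.1)) ⁻¹' B) := by
    ext p
    simp only [crossingPairs, Set.mem_inter_iff, Set.mem_ofPred_eq, Set.mem_preimage]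
    exact and_congr_right fun h => segment_inter_nonempty_iff hB h
  rw [this]
  refine (measurableSet_lt (hm0.comp measurable_fst) (hm0.comp measurable_snd)).inter
    ((ht measurableSet_Icc).inter ?_)
  exact (measurable_fst.add (ht.smul (measurable_snd.sub measurable_fst))) hBm

lemma directedSpanningTree_eq_of_forall {φ : Set (EuclideanSpace ℝ (Fin d))}
    {y w : EuclideanSpace ℝ (Fin d)} (h : nearestRight y φ = {w}) :
    directedSpanningTree y φ = w := by
  have hex : ∃ z ∈ nearestRight y φ, ∀ w ∈ nearestRight y φ,
      toLex (WithLp.ofLp z) ≤ toLex (WithLp.ofLp w) := by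
    rw [h]
    exact ⟨w, rfl, by rintro _ rfl; exact le_rfl⟩
  rw [directedSpanningTree, dif_pos hex]
  exact h.subset hex.choose_spec.1

/-- A void enlarged zone leaves w as the unique nearest point to the right, so the tie-breaking rule
plays no role and each y occurs in at most one pair. -/
lemma voidPairs_nearZone_encard_le {ε : ℝ} (hε : 0 < ε) (φ B : Set (EuclideanSpace ℝ (Fin d))) :
    (voidPairs φ (nearZone d ε) ∩ crossingPairs B).encard ≤
      (linksThrough directedSpanningTree φ B).encard := by
  have key : ∀ p ∈ voidPairs φ (nearZone d ε) ∩ crossingPairs B,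
      directedSpanningTree p.1 φ = p.2 := by
    rintro ⟨y, w⟩ ⟨⟨⟨hy, hw⟩, hdis⟩, hlt, -⟩
    dsimp only at hy hw hlt ⊢
    have hv : ∀ v ∈ φ, y 0 < v 0 → v ≠ w → dist y w + ε ≤ dist y v := fun v hv h0 hne => by
      by_contra! hcon
      exact Set.disjoint_left.1 hdis hv ⟨h0, hcon, hne⟩
    refine directedSpanningTree_eq_of_forall ?_
    ext v
    simp only [nearestRight, Set.mem_ofPred_eq, Set.mem_singleton_iff]
    constructor
    · rintro ⟨h1, h2, h3⟩
      by_contra hne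
      have := hv v h1 h2 hne
      have := h3 w hw hlt
      linarith
    · rintro rfl
      refine ⟨hw, hlt, fun u hu hu0 => ?_⟩
      by_cases hne : u = v
      · rw [hne]
      · have := hv u hu hu0 hne
        linarith
  refine Set.encard_le_encard_of_injOn (f := Prod.fst) ?_ ?_
  · intro p hp
    refine ⟨hp.1.1.1, ?_⟩
    rw [key p hp]
    exact hp.2.2
  · intro p hp q hq hpq
    refine Prod.ext hpq ?_
    rw [← key p hp, ← key q hq, hpq]

/-- With ε = 0 tied pairs are all counted, which only helps an upper bound. A point without
successor has the degenerate link {y} and matters only if it lies in B. -/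
lemma linksThrough_encard_le (φ B : Set (EuclideanSpace ℝ (Fin d))) :
    (linksThrough directedSpanningTree φ B).encard ≤
      (voidPairs φ (nearZone d 0) ∩ crossingPairs B).encard + (φ ∩ B).encard := by
  rw [← Set.encard_sdiff_add_encard_inter (linksThrough directedSpanningTree φ B) B]
  refine add_le_add ?_ (Set.encard_le_encard fun y hy => ⟨hy.1.1, hy.2⟩)
  refine Set.encard_le_encard_of_injOn (f := fun y => (y, directedSpanningTree y φ)) ?_ ?_
  · rintro y ⟨⟨hy, hseg⟩, hyB⟩
    by_cases hex : ∃ z ∈ nearestRight y φ, ∀ w ∈ nearestRight y φ,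
      toLex (WithLp.ofLp z) ≤ toLex (WithLp.ofLp w)
    · have hz : directedSpanningTree y φ ∈ nearestRight y φ := by
        rw [directedSpanningTree, dif_pos hex]
        exact hex.choose_spec.1
      refine ⟨⟨⟨hy, hz.1⟩, ?_⟩, hz.2.1, hseg⟩
      rw [Set.disjoint_left]
      rintro v hv ⟨h0, h1, -⟩
      have := hz.2.2 v hv h0
      simp only [add_zero] at h1
      linarith
    · rw [directedSpanningTree, dif_neg hex] at hseg
      simp [hyB] at hseg
  · intro y _ w _ h
    exact congrArg Prod.fst h

variable {Ω : Type*} [MeasurableSpace Ω] {P : Measure Ω}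
  {X : Ω → Set (EuclideanSpace ℝ (Fin d))} {Λ : Measure (EuclideanSpace ℝ (Fin d))}

lemma isBounded_nearZone (ε : ℝ) (p : EuclideanSpace ℝ (Fin d) × EuclideanSpace ℝ (Fin d)) :
    Bornology.IsBounded (Prod.mk p ⁻¹' nearZone d ε) := by
  refine (Metric.isBounded_ball (x := p.1) (r := dist p.1 p.2 + ε)).subset fun v hv => ?_
  rw [Metric.mem_ball']
  exact hv.2.1

/-- In the limit the enlarged zones gain at most part of a sphere of positive radius, which is a
null set. -/
lemma tendsto_measure_nearZone (hac : Λ ≪ volume) (hΛ : ∀ K, Bornology.IsBounded K → Λ K ≠ ∞)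
    {p : EuclideanSpace ℝ (Fin d) × EuclideanSpace ℝ (Fin d)} (hp : p.1 0 < p.2 0) :
    Tendsto (fun k : ℕ => Λ (Prod.mk p ⁻¹' nearZone d (1 / (k + 1)))) atTop
      (𝓝 (Λ (Prod.mk p ⁻¹' nearZone d 0))) := by
  have hne : dist p.1 p.2 ≠ 0 := by
    rw [dist_ne_zero]
    intro h
    rw [h] at hp
    exact lt_irrefl _ hp
  have h1 := tendsto_measure_iInter_atTop (μ := Λ)
    (s := fun k : ℕ => Prod.mk p ⁻¹' nearZone d (1 / ((k : ℝ) + 1)))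
    (fun k => (measurable_prodMk_left (isOpen_nearZone _).measurableSet).nullMeasurableSet)
    (fun k l hkl => Set.preimage_mono (nearZone_mono
      (one_div_le_one_div_of_le (by positivity) (by gcongr))))
    ⟨0, hΛ _ (isBounded_nearZone _ p)⟩
  have h2 : Λ (⋂ k : ℕ, Prod.mk p ⁻¹' nearZone d (1 / ((k : ℝ) + 1))) =
      Λ (Prod.mk p ⁻¹' nearZone d 0) := by
    refine le_antisymm ?_ (measure_mono ?_)
    · have hsph : Λ (Metric.sphere p.1 (dist p.1 p.2)) = 0 :=
        hac (Measure.addHaar_sphere_of_ne_zero _ _ hne)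
      calc _ ≤ Λ (Prod.mk p ⁻¹' nearZone d 0 ∪ Metric.sphere p.1 (dist p.1 p.2)) := by
            refine measure_mono fun v hv => ?_
            rw [Set.mem_iInter] at hv
            have hle : dist p.1 v ≤ dist p.1 p.2 := by
              have ht : Tendsto (fun k : ℕ => dist p.1 p.2 + 1 / ((k : ℝ) + 1)) atTop
                  (𝓝 (dist p.1 p.2 + 0)) :=
                tendsto_const_nhds.add tendsto_one_div_add_atTop_nhds_zero_nat
              rw [add_zero] at ht
              exact ge_of_tendsto' ht fun k => (hv k).2.1.le
            rcases hle.lt_or_eq with h | h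
            · exact Or.inl ⟨(hv 0).1, by simpa using h, (hv 0).2.2⟩
            · refine Or.inr ?_
              rw [Metric.mem_sphere']
              exact h
        _ ≤ _ := (measure_union_le _ _).trans (by rw [hsph, add_zero])
    · exact Set.subset_iInter fun k => Set.preimage_mono (nearZone_mono (by positivity))
  rw [h2] at h1
  exact h1

lemma crossingPairs_nearZone (B : Set (EuclideanSpace ℝ (Fin d))) (ε : ℝ) :
    ∀ p ∈ crossingPairs B, (p, p.1) ∉ nearZone d ε ∧ (p, p.2) ∉ nearZone d ε :=
  fun _ _ => ⟨fun h => lt_irrefl _ h.1, fun h => h.2.2 rfl⟩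

/-- The counts with ε > 0 bound the link count from below. They increase as ε decreases, stay below
the count with ε = 0, and their means converge to its mean; hence their supremum equals it almost
surely. Truncation to a ball keeps the means finite. -/
lemma ae_voidPairs_nearZone_le (hX : IsPoissonProcess P X Λ) [SFinite Λ]
    [IsProbabilityMeasure P] (hac : Λ ≪ volume) (hΛ : ∀ K, Bornology.IsBounded K → Λ K ≠ ∞)
    {B : Set (EuclideanSpace ℝ (Fin d))} (hS : MeasurableSet (crossingPairs B)) (n : ℕ) :
    ∀ᵐ ω ∂P, pointMeasure (voidPairs (X ω) (nearZone d 0))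
      (crossingPairs B ∩ Metric.ball 0 n ×ˢ Metric.ball 0 n) ≤
        linkCount directedSpanningTree X B ω := by
  set S := crossingPairs B ∩
    Metric.ball (0 : EuclideanSpace ℝ (Fin d)) n ×ˢ Metric.ball 0 n with hSdef
  have hSm : MeasurableSet S := hS.inter (measurableSet_ball.prod measurableSet_ball)
  let N : ℝ → Ω → ℝ≥0∞ := fun ε ω => pointMeasure (voidPairs (X ω) (nearZone d ε)) S
  have hNm : ∀ ε, Measurable (N ε) := fun ε => (Measure.measurable_coe hSm).comp
    (measurable_pointMeasure_voidPairs hX (isOpen_nearZone ε).measurableSet)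
  have hNE : ∀ ε, ∫⁻ ω, N ε ω ∂P =
      ∫⁻ p in S, P {ω | Disjoint (X ω) (Prod.mk p ⁻¹' nearZone d ε)} ∂(Λ.prod Λ) := fun ε => by
    rw [← voidPairIntensity_apply hX (isOpen_nearZone ε).measurableSet hSm]
    exact voidPairIntensity_eq_setLIntegral hX hΛ (isOpen_nearZone ε) hSm
      (fun p hp => hp.1.1) fun p hp => crossingPairs_nearZone B ε p hp.1
  have hSfin : (Λ.prod Λ) S ≠ ∞ := by
    refine measure_ne_top_of_subset Set.inter_subset_right ?_
    rw [Measure.prod_prod]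
    exact ENNReal.mul_ne_top (hΛ _ Metric.isBounded_ball) (hΛ _ Metric.isBounded_ball)
  have hbound : ∀ ε, ∫⁻ ω, N ε ω ∂P ≠ ∞ := fun ε => by
    rw [hNE]
    refine ((setLIntegral_mono measurable_const fun p _ => prob_le_one).trans_lt ?_).ne
    simpa using hSfin.lt_top
  have hle : ∀ k : ℕ, ∀ ω, N (1 / ((k : ℝ) + 1)) ω ≤ N 0 ω := fun k ω =>
    pointMeasure_mono (voidPairs_anti _ (nearZone_mono (by positivity))) hSm
  have hlim : Tendsto (fun k : ℕ => ∫⁻ ω, N (1 / ((k : ℝ) + 1)) ω ∂P) atTop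
      (𝓝 (∫⁻ ω, N 0 ω ∂P)) := by
    simp_rw [hNE]
    refine tendsto_lintegral_of_dominated_convergence (fun _ => 1)
      (fun k => measurable_measure_disjoint hX (isOpen_nearZone _).measurableSet)
      (fun k => Eventually.of_forall fun p => prob_le_one) (by simpa using hSfin) ?_
    filter_upwards [ae_restrict_mem hSm] with p hp
    have hvoid : ∀ ε, P {ω | Disjoint (X ω) (Prod.mk p ⁻¹' nearZone d ε)} =
        ENNReal.ofReal (Real.exp (-(Λ (Prod.mk p ⁻¹' nearZone d ε)).toReal)) := fun ε =>
      hX.measure_disjoint (measurable_prodMk_left (isOpen_nearZone ε).measurableSet)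
        (hΛ _ (isBounded_nearZone ε p))
    simp_rw [hvoid]
    exact ENNReal.tendsto_ofReal ((Real.continuous_exp.tendsto _).comp
      ((ENNReal.tendsto_toReal (hΛ _ (isBounded_nearZone 0 p))).comp
        (tendsto_measure_nearZone hac hΛ hp.1.1)).neg)
  have hsup : (fun ω => ⨆ k : ℕ, N (1 / ((k : ℝ) + 1)) ω) =ᵐ[P] N 0 := by
    refine ae_eq_of_ae_le_of_lintegral_le (Eventually.of_forall fun ω => iSup_le fun k => hle k ω)
      ?_ (hNm 0).aemeasurable ?_
    · exact ((lintegral_mono fun ω => iSup_le fun k => hle k ω).trans_lt (hbound 0).lt_top).ne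
    · exact le_of_tendsto' hlim fun k =>
        lintegral_mono fun ω => le_iSup (fun k : ℕ => N (1 / ((k : ℝ) + 1)) ω) k
  filter_upwards [hsup] with ω hω
  change N 0 ω ≤ _
  rw [← hω]
  refine iSup_le fun k => ?_
  change pointMeasure _ S ≤ _
  rw [pointMeasure_apply _ hSm]
  refine ENat.toENNReal_le.2 ((Set.encard_le_encard ?_).trans
    (voidPairs_nearZone_encard_le (ε := 1 / ((k : ℝ) + 1)) (by positivity) (X ω) B))
  exact Set.inter_subset_inter_right _ Set.inter_subset_left

lemma volume_hyperplane (c : ℝ) : volume {y : EuclideanSpace ℝ (Fin d) | y 0 = c} = 0 := by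
  have h := Measure.addHaar_affineSubspace (volume : Measure (EuclideanSpace ℝ (Fin d)))
    (AffineSubspace.mk' (c • EuclideanSpace.single 0 1)
      (EuclideanSpace.proj (𝕜 := ℝ) (0 : Fin d)).toLinearMap.ker) ?_
  · refine measure_mono_null (fun y hy => ?_) h
    have hy' : y 0 = c := hy
    simp [AffineSubspace.mem_mk', hy']
  · intro htop
    have : (c • EuclideanSpace.single 0 1 + EuclideanSpace.single 0 1 :
        EuclideanSpace ℝ (Fin d)) ∈ (⊤ : AffineSubspace ℝ (EuclideanSpace ℝ (Fin d))) := trivial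
    rw [← htop] at this
    simp [AffineSubspace.mem_mk'] at this

/-- The upper and lower bounds meet because almost surely no point of the process lies in the null
set B. The link count is thus measurable up to null sets, although the navigation itself is never
shown to be measurable. -/
lemma linkCount_ae_eq (hX : IsPoissonProcess P X Λ) [SFinite Λ]
    [IsProbabilityMeasure P] (hac : Λ ≪ volume) (hΛ : ∀ K, Bornology.IsBounded K → Λ K ≠ ∞)
    {c : ℝ} {B : Set (EuclideanSpace ℝ (Fin d))} (hB : B ⊆ {y | y 0 = c}) (hBm : MeasurableSet B) :
    linkCount directedSpanningTree X B =ᵐ[P]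
      fun ω => pointMeasure (voidPairs (X ω) (nearZone d 0)) (crossingPairs B) := by
  have hS := measurableSet_crossingPairs hB hBm
  have hΛB : Λ B = 0 := hac (measure_mono_null hB (volume_hyperplane c))
  have hdis : ∀ᵐ ω ∂P, Disjoint (X ω) B := by
    have h1 := hX.measure_disjoint hBm (by simp [hΛB])
    rw [hΛB] at h1
    simp only [ENNReal.toReal_zero, neg_zero, Real.exp_zero, ENNReal.ofReal_one] at h1
    exact (prob_compl_eq_zero_iff (measurableSet_disjoint hX hBm)).2 h1
  filter_upwards [hdis, ae_all_iff.2 fun n => ae_voidPairs_nearZone_le hX hac hΛ hS n] with ω h0 h1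
  refine le_antisymm ?_ ?_
  · rw [pointMeasure_apply _ hS]
    refine ENat.toENNReal_le.2 ((linksThrough_encard_le (X ω) B).trans ?_)
    rw [Set.disjoint_iff_inter_eq_empty.1 h0]
    simp
  · have hU : crossingPairs B = ⋃ n : ℕ, crossingPairs B ∩
        Metric.ball (0 : EuclideanSpace ℝ (Fin d)) n ×ˢ Metric.ball 0 n := by
      rw [← Set.inter_iUnion]
      refine (Set.inter_eq_left.2 fun p _ => ?_).symm
      obtain ⟨n, hn⟩ := exists_nat_gt (max ‖p.1‖ ‖p.2‖)
      refine Set.mem_iUnion.2 ⟨n, ?_, ?_⟩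
      · simpa using (le_max_left _ _).trans_lt hn
      · simpa using (le_max_right _ _).trans_lt hn
    have hmono : Monotone fun n : ℕ => crossingPairs B ∩
        Metric.ball (0 : EuclideanSpace ℝ (Fin d)) n ×ˢ Metric.ball 0 n := fun m n hmn =>
      Set.inter_subset_inter_right _ (Set.prod_mono (Metric.ball_subset_ball (by exact_mod_cast hmn))
        (Metric.ball_subset_ball (by exact_mod_cast hmn)))
    rw [hU, hmono.measure_iUnion]
    exact iSup_le h1

theorem lintegral_linkCount (hX : IsPoissonProcess P X Λ) [SFinite Λ]
    [IsProbabilityMeasure P] (hac : Λ ≪ volume) (hΛ : ∀ K, Bornology.IsBounded K → Λ K ≠ ∞)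
    {c : ℝ} {B : Set (EuclideanSpace ℝ (Fin d))} (hB : B ⊆ {y | y 0 = c}) (hBm : MeasurableSet B) :
    AEMeasurable (linkCount directedSpanningTree X B) P ∧
    ∫⁻ ω, linkCount directedSpanningTree X B ω ∂P =
      ∫⁻ p in crossingPairs B, ENNReal.ofReal
        (Real.exp (-(Λ (Prod.mk p ⁻¹' nearZone d 0)).toReal)) ∂(Λ.prod Λ) := by
  have hS := measurableSet_crossingPairs hB hBm
  have h := linkCount_ae_eq hX hac hΛ hB hBm
  refine ⟨((Measure.measurable_coe hS).comp (measurable_pointMeasure_voidPairs hX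
    (isOpen_nearZone 0).measurableSet)).aemeasurable.congr h.symm, ?_⟩
  rw [lintegral_congr_ae h, ← voidPairIntensity_apply hX (isOpen_nearZone 0).measurableSet hS,
    voidPairIntensity_eq_setLIntegral hX hΛ (isOpen_nearZone 0) hS (fun p hp => hp.1)
      (crossingPairs_nearZone B 0)]
  refine setLIntegral_congr_fun hS fun p _ => ?_
  exact hX.measure_disjoint (measurable_prodMk_left (isOpen_nearZone 0).measurableSet)
    (hΛ _ (isBounded_nearZone 0 p))

end Links
end DirectedNetwork

namespace DirectedNetwork

/-! ### Volumes of prisms and half balls; the limiting intensity. -/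

section Volumes

variable {d : ℕ} [NeZero d]

/-- The starting points `y` for which the segment `[y, y + z]` hits `B`. -/
def segmentShadow (z : EuclideanSpace ℝ (Fin d)) (B : Set (EuclideanSpace ℝ (Fin d))) :
    Set (EuclideanSpace ℝ (Fin d)) :=
  {y | (segment ℝ y (y + z) ∩ B).Nonempty}

lemma mk_preimage_crossingPairs {z : EuclideanSpace ℝ (Fin d)} (hz : 0 < z 0)
    (B : Set (EuclideanSpace ℝ (Fin d))) :
    (fun y => (y, y + z)) ⁻¹' crossingPairs B = segmentShadow z B := by
  ext y
  simp [crossingPairs, segmentShadow, hz]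

lemma measurableSet_segmentShadow {z : EuclideanSpace ℝ (Fin d)} (hz : 0 < z 0) {c : ℝ}
    {B : Set (EuclideanSpace ℝ (Fin d))} (hB : B ⊆ {y | y 0 = c}) (hBm : MeasurableSet B) :
    MeasurableSet (segmentShadow z B) := by
  rw [← mk_preimage_crossingPairs hz]
  exact (measurable_id.prodMk (measurable_id.add_const z)) (measurableSet_crossingPairs hB hBm)

/-- The shadow of a subset of a hyperplane is a prism over this subset. -/
lemma volume_segmentShadow {z : EuclideanSpace ℝ (Fin d)} (hz : 0 < z 0) {c : ℝ}
    {B : Set (EuclideanSpace ℝ (Fin d))} (hB : B ⊆ {y | y 0 = c}) (hBm : MeasurableSet B) :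
    volume (segmentShadow z B) = ENNReal.ofReal (z 0) * μHE[d - 1] B := by
  have hfin : Module.finrank ℝ (EuclideanSpace ℝ (Fin d)) = d := finrank_euclideanSpace_fin
  have hv : EuclideanSpace.single (0 : Fin d) (1 : ℝ) ≠ 0 := by simp
  have h := EuclideanGeometry.euclideanHausdorffMeasure_eq_lintegral
    (0 : EuclideanSpace ℝ (Fin d)) hv (measurableSet_segmentShadow hz hB hBm)
  rw [hfin, EuclideanSpace.euclideanHausdorffMeasure_eq_volume] at h
  rw [h]
  -- Slicing along e₁: at height r in [c - z₀, c] the slice is a translate of B along z, at other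
  -- heights it is empty.
  have hslice : ∀ r : ℝ, μHE[d - 1] (segmentShadow z B ∩
      AffineSubspace.mk' (r • EuclideanSpace.single (0 : Fin d) (1 : ℝ) +ᵥ
        (0 : EuclideanSpace ℝ (Fin d))) (ℝ ∙ EuclideanSpace.single (0 : Fin d) (1 : ℝ))ᗮ) =
      (Set.Icc (c - z 0) c).indicator (fun _ => μHE[d - 1] B) r := fun r => by
    have hmem : ∀ y : EuclideanSpace ℝ (Fin d), y ∈ (AffineSubspace.mk'
        (r • EuclideanSpace.single (0 : Fin d) (1 : ℝ) +ᵥ (0 : EuclideanSpace ℝ (Fin d)))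
        (ℝ ∙ EuclideanSpace.single (0 : Fin d) (1 : ℝ))ᗮ : Set (EuclideanSpace ℝ (Fin d))) ↔
        y 0 = r := fun y => by
      rw [SetLike.mem_coe, AffineSubspace.mem_mk', Submodule.mem_orthogonal_singleton_iff_inner_right,
        EuclideanSpace.inner_single_left]
      simp [sub_eq_zero]
    have hiff : ∀ y : EuclideanSpace ℝ (Fin d), y 0 = r → (y ∈ segmentShadow z B ↔
        (c - r) / z 0 ∈ Set.Icc (0 : ℝ) 1 ∧ y + ((c - r) / z 0) • z ∈ B) := fun y hy => by
      have := segment_inter_nonempty_iff hB (y := y) (w := y + z) (by simpa using hz)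
      simpa [segmentShadow, hy] using this
    have hIcc : (c - r) / z 0 ∈ Set.Icc (0 : ℝ) 1 ↔ r ∈ Set.Icc (c - z 0) c := by
      rw [Set.mem_Icc, Set.mem_Icc, le_div_iff₀ hz, div_le_iff₀ hz]
      constructor <;> rintro ⟨h1, h2⟩ <;> constructor <;> linarith
    by_cases hr : r ∈ Set.Icc (c - z 0) c
    · rw [Set.indicator_of_mem hr,
        ← measure_preimage_add_right (μHE[d - 1]) (((c - r) / z 0) • z) B]
      congr 1
      ext y
      rw [Set.mem_inter_iff, hmem, Set.mem_preimage]
      constructor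
      · rintro ⟨h1, h2⟩
        exact ((hiff y h2).1 h1).2
      · intro h1
        have h2 : y 0 + (c - r) / z 0 * z 0 = c := by simpa using hB h1
        rw [div_mul_cancel₀ _ hz.ne'] at h2
        have h3 : y 0 = r := by linarith
        exact ⟨(hiff y h3).2 ⟨hIcc.2 hr, h1⟩, h3⟩
    · rw [Set.indicator_of_notMem hr]
      have : segmentShadow z B ∩ (AffineSubspace.mk'
        (r • EuclideanSpace.single (0 : Fin d) (1 : ℝ) +ᵥ (0 : EuclideanSpace ℝ (Fin d)))
        (ℝ ∙ EuclideanSpace.single (0 : Fin d) (1 : ℝ))ᗮ : Set (EuclideanSpace ℝ (Fin d))) = ∅ := by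
        ext y
        rw [Set.mem_inter_iff, hmem]
        simp only [Set.mem_empty_iff_false, iff_false, not_and]
        intro h1 h2
        exact hr (hIcc.1 ((hiff y h2).1 h1).1)
      rw [this, measure_empty]
  simp_rw [hslice]
  have he : ‖EuclideanSpace.single (0 : Fin d) (1 : ℝ)‖ₑ = 1 := by
    rw [← ofReal_norm]
    simp
  rw [lintegral_indicator_const measurableSet_Icc, Real.volume_Icc, he]
  simp [mul_comm]

lemma hyperplaneBall_subset (p : EuclideanSpace ℝ (Fin d)) (r : ℝ) :
    hyperplaneBall p r ⊆ {y | y 0 = p 0} := Set.inter_subset_right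

lemma measurableSet_hyperplaneBall (p : EuclideanSpace ℝ (Fin d)) (r : ℝ) :
    MeasurableSet (hyperplaneBall p r) := by
  have hm0 : Measurable fun y : EuclideanSpace ℝ (Fin d) => y 0 := by fun_prop
  exact measurableSet_ball.inter (hm0 (measurableSet_singleton (p 0)))

/-- The prism of height one in direction e₁ has Lebesgue volume equal to the measure of its base. It
contains a nonempty open set and lies in a ball of radius r + 1. -/
lemma euclideanHausdorffMeasure_hyperplaneBall (p : EuclideanSpace ℝ (Fin d)) {r : ℝ}
    (hr : 0 < r) :
    μHE[d - 1] (hyperplaneBall p r) ≠ 0 ∧ μHE[d - 1] (hyperplaneBall p r) ≠ ∞ := by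
  set e : EuclideanSpace ℝ (Fin d) := EuclideanSpace.single (0 : Fin d) (1 : ℝ) with he
  have he0 : e 0 = 1 := by simp [he]
  have hz : 0 < e 0 := by rw [he0]; exact one_pos
  have hvol := volume_segmentShadow hz (hyperplaneBall_subset p r) (measurableSet_hyperplaneBall p r)
  rw [he0, ENNReal.ofReal_one, one_mul] at hvol
  rw [← hvol]
  constructor
  · let U : Set (EuclideanSpace ℝ (Fin d)) := {y | p 0 - 1 < y 0} ∩ {y | y 0 < p 0} ∩
      (fun y => y + (p 0 - y 0) • e) ⁻¹' Metric.ball p r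
    have hU : IsOpen U := by
      refine ((isOpen_lt (by fun_prop) (by fun_prop)).inter
        (isOpen_lt (by fun_prop) (by fun_prop))).inter ?_
      exact Metric.isOpen_ball.preimage (by fun_prop)
    have hUn : U.Nonempty := by
      refine ⟨p - (1 / 2 : ℝ) • e, ⟨?_, ?_⟩, ?_⟩
      · simp [he0]; norm_num
      · simp [he0]
      · simp [he0, hr]
    refine (hU.measure_pos volume hUn).ne' ∘ measure_mono_null ?_
    intro y hy
    have h1 : p 0 - 1 < y 0 := hy.1.1
    have h2 : y 0 < p 0 := hy.1.2
    refine (segment_inter_nonempty_iff (hyperplaneBall_subset p r)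
      (by simp [he0])).2 ?_
    have h3 : (y + e) 0 - y 0 = 1 := by simp [he0]
    rw [h3, div_one]
    refine ⟨⟨by linarith, by linarith⟩, ?_, ?_⟩
    · simpa using hy.2
    · simp [he0]
  · refine ((measure_mono ?_).trans_lt (measure_ball_lt_top (x := p) (r := r + 1))).ne
    rintro y ⟨v, hv, hvB⟩
    rw [segment_eq_image'] at hv
    obtain ⟨t, ht, rfl⟩ := hv
    have h1 := hvB.1
    rw [Metric.mem_ball] at h1 ⊢
    calc dist y p ≤ dist y (y + t • (y + e - y)) + dist (y + t • (y + e - y)) p :=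
          dist_triangle _ _ _
      _ < 1 + r := by
          refine add_lt_add_of_le_of_lt ?_ h1
          simp [he, norm_smul, abs_of_nonneg ht.1, ht.2]
      _ = r + 1 := add_comm _ _

/-- The open half ball of radius `r` around `y` to the right of `y`. -/
def halfBall (y : EuclideanSpace ℝ (Fin d)) (r : ℝ) : Set (EuclideanSpace ℝ (Fin d)) :=
  {v | y 0 < v 0 ∧ dist v y < r}

lemma mk_preimage_nearZone (y w : EuclideanSpace ℝ (Fin d)) :
    Prod.mk (y, w) ⁻¹' nearZone d 0 = halfBall y (dist w y) := by
  ext v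
  simp only [nearZone, halfBall, Set.mem_preimage, Set.mem_ofPred_eq, add_zero, dist_comm y]
  refine ⟨fun h => ⟨h.1, h.2.1⟩, fun h => ⟨h.1, h.2, ?_⟩⟩
  rintro rfl
  exact lt_irrefl _ h.2

lemma isOpen_halfBall (y : EuclideanSpace ℝ (Fin d)) (r : ℝ) : IsOpen (halfBall y r) := by
  have h1 : IsOpen {v : EuclideanSpace ℝ (Fin d) | y 0 < v 0} :=
    isOpen_lt (by fun_prop) (by fun_prop)
  exact h1.inter Metric.isOpen_ball

lemma halfBall_subset_ball (y : EuclideanSpace ℝ (Fin d)) (r : ℝ) :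
    halfBall y r ⊆ Metric.ball y r := fun _ hv => hv.2

/-- The volume of the half ball of radius one. -/
noncomputable def unitHalfBallVolume (d : ℕ) [NeZero d] : ℝ :=
  (volume (halfBall (0 : EuclideanSpace ℝ (Fin d)) 1)).toReal

lemma volume_halfBall_ne_top (y : EuclideanSpace ℝ (Fin d)) (r : ℝ) : volume (halfBall y r) ≠ ∞ :=
  ((measure_mono (halfBall_subset_ball y r)).trans_lt measure_ball_lt_top).ne

lemma unitHalfBallVolume_pos : 0 < unitHalfBallVolume d := by
  refine ENNReal.toReal_pos ?_ (volume_halfBall_ne_top _ _)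
  refine ((isOpen_halfBall _ _).measure_pos volume ⟨EuclideanSpace.single 0 (1 / 2 : ℝ), ?_, ?_⟩).ne'
  · simp
  · simp [inv_lt_one_of_one_lt₀]

lemma volume_halfBall (y : EuclideanSpace ℝ (Fin d)) {r : ℝ} (hr : 0 < r) :
    volume (halfBall y r) = ENNReal.ofReal (r ^ d * unitHalfBallVolume d) := by
  have h1 : halfBall y r = y +ᵥ (r • halfBall (0 : EuclideanSpace ℝ (Fin d)) 1) := by
    ext v
    rw [Set.mem_vadd_set_iff_neg_vadd_mem, Set.mem_smul_set_iff_inv_smul_mem₀ hr.ne']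
    simp only [halfBall, Set.mem_ofPred_eq, vadd_eq_add, PiLp.zero_apply, PiLp.smul_apply,
      PiLp.add_apply, PiLp.neg_apply, smul_eq_mul]
    rw [dist_zero_right, norm_smul, norm_inv, Real.norm_eq_abs, abs_of_pos hr, dist_eq_norm,
      inv_mul_lt_iff₀ hr, mul_one, neg_add_eq_sub y v]
    have : 0 < r⁻¹ * (-y 0 + v 0) ↔ y 0 < v 0 := by
      rw [mul_pos_iff_of_pos_left (inv_pos.2 hr)]
      constructor <;> intro h <;> linarith
    rw [this]
  rw [h1, measure_vadd, Measure.addHaar_smul, finrank_euclideanSpace_fin,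
    abs_of_pos (pow_pos hr d), ENNReal.ofReal_mul (pow_pos hr d).le, unitHalfBallVolume,
    ENNReal.ofReal_toReal (volume_halfBall_ne_top _ _)]

/-- In polar coordinates the radial integrand is r^d exp(-a r^d). -/
lemma lintegral_norm_mul_exp_lt_top {a : ℝ} (ha : 0 < a) :
    ∫⁻ z : EuclideanSpace ℝ (Fin d), ENNReal.ofReal (‖z‖ * Real.exp (-(a * ‖z‖ ^ d))) < ∞ := by
  have hd : (0 : ℝ) < d := Nat.cast_pos.2 (NeZero.pos d)
  have : Nontrivial (EuclideanSpace ℝ (Fin d)) :=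
    Module.nontrivial_of_finrank_pos (R := ℝ) (by
      rw [finrank_euclideanSpace_fin]; exact NeZero.pos d)
  have hint : Integrable (fun z : EuclideanSpace ℝ (Fin d) => ‖z‖ * Real.exp (-(a * ‖z‖ ^ d))) := by
    refine (integrable_fun_norm_addHaar volume
      (f := fun r : ℝ => r * Real.exp (-(a * r ^ d)))).2 ?_
    rw [finrank_euclideanSpace_fin]
    refine (integrableOn_rpow_mul_exp_neg_mul_rpow (p := d) (s := d) (by linarith) hd ha).congr_fun
      (fun r hr => ?_) measurableSet_Ioi
    simp only [Real.rpow_natCast, smul_eq_mul, neg_mul]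
    rw [← mul_assoc, pow_sub_one_mul (NeZero.ne d)]
  rw [← ofReal_integral_eq_lintegral_ofReal hint (Eventually.of_forall fun z => by positivity)]
  exact ENNReal.ofReal_lt_top

/-- The intensity with which the links of the directed spanning tree on a homogeneous Poisson
process of intensity `γ` cross a hyperplane perpendicular to the first coordinate axis. -/
noncomputable def crossingIntensity (d : ℕ) [NeZero d] (γ : ℝ) : ℝ :=
  (∫⁻ z : EuclideanSpace ℝ (Fin d),
    ENNReal.ofReal (z 0 * (γ ^ 2 * Real.exp (-(γ * (‖z‖ ^ d * unitHalfBallVolume d)))))).toReal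

lemma abs_apply_zero_le_norm (z : EuclideanSpace ℝ (Fin d)) : |z 0| ≤ ‖z‖ := by
  simpa using PiLp.norm_apply_le z 0

lemma crossingIntensity_lintegral_ne_top {γ : ℝ} (hγ : 0 < γ) :
    ∫⁻ z : EuclideanSpace ℝ (Fin d), ENNReal.ofReal
      (z 0 * (γ ^ 2 * Real.exp (-(γ * (‖z‖ ^ d * unitHalfBallVolume d))))) ≠ ∞ := by
  have h := lintegral_norm_mul_exp_lt_top (d := d) (mul_pos hγ (unitHalfBallVolume_pos (d := d)))
  have h2 := ENNReal.mul_lt_top (ENNReal.ofReal_lt_top (r := γ ^ 2)) h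
  rw [← lintegral_const_mul _ (by fun_prop)] at h2
  refine ((lintegral_mono fun z => ?_).trans_lt h2).ne
  rw [← ENNReal.ofReal_mul (by positivity)]
  refine ENNReal.ofReal_le_ofReal ?_
  have h3 : γ * (‖z‖ ^ d * unitHalfBallVolume d) = γ * unitHalfBallVolume d * ‖z‖ ^ d := by ring
  rw [h3, mul_left_comm]
  gcongr
  exact (le_abs_self _).trans (abs_apply_zero_le_norm z)

lemma ofReal_crossingIntensity {γ : ℝ} (hγ : 0 < γ) :
    ENNReal.ofReal (crossingIntensity d γ) = ∫⁻ z : EuclideanSpace ℝ (Fin d), ENNReal.ofReal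
      (z 0 * (γ ^ 2 * Real.exp (-(γ * (‖z‖ ^ d * unitHalfBallVolume d))))) :=
  ENNReal.ofReal_toReal (crossingIntensity_lintegral_ne_top hγ)

lemma crossingIntensity_pos {γ : ℝ} (hγ : 0 < γ) : 0 < crossingIntensity d γ := by
  refine ENNReal.toReal_pos ?_ (crossingIntensity_lintegral_ne_top hγ)
  rw [← pos_iff_ne_zero, lintegral_pos_iff_support (by fun_prop)]
  have hU : IsOpen {z : EuclideanSpace ℝ (Fin d) | 0 < z 0} :=
    isOpen_lt (by fun_prop) (by fun_prop)
  refine (hU.measure_pos volume ⟨EuclideanSpace.single 0 1, by simp⟩).trans_le (measure_mono ?_)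
  intro z hz
  have hz' : 0 < z 0 := hz
  rw [Function.mem_support, ← pos_iff_ne_zero, ENNReal.ofReal_pos]
  positivity

end Volumes

/-! ### Expected link counts as integrals over displacements; the homogeneous case. -/

section LinkIntegral

variable {d : ℕ} [NeZero d] {Ω : Type*} [MeasurableSpace Ω] {P : Measure Ω}
  {X : Ω → Set (EuclideanSpace ℝ (Fin d))}

/-- The density of the links `(y, w)` of the directed spanning tree on a Poisson process with
intensity function `ℓ`. -/
noncomputable def linkDensity (ℓ : EuclideanSpace ℝ (Fin d) → ℝ≥0∞)
    (p : EuclideanSpace ℝ (Fin d) × EuclideanSpace ℝ (Fin d)) : ℝ≥0∞ :=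
  ℓ p.1 * ℓ p.2 * ENNReal.ofReal
    (Real.exp (-((volume.withDensity ℓ) (Prod.mk p ⁻¹' nearZone d 0)).toReal))

lemma measurable_linkDensity {ℓ : EuclideanSpace ℝ (Fin d) → ℝ≥0∞} (hℓ : Measurable ℓ) :
    Measurable (linkDensity ℓ) := by
  have h1 := measurable_measure_prodMk_left (ν := volume.withDensity ℓ)
    (isOpen_nearZone (d := d) 0).measurableSet
  exact ((hℓ.comp measurable_fst).mul (hℓ.comp measurable_snd)).mul
    (Real.measurable_exp.comp h1.ennreal_toReal.neg).ennreal_ofReal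

theorem lintegral_linkCount_withDensity {ℓ : EuclideanSpace ℝ (Fin d) → ℝ≥0∞}
    (hX : IsPoissonProcess P X (volume.withDensity ℓ)) [IsProbabilityMeasure P]
    (hℓ : Measurable ℓ) {M : ℝ} (hM : ∀ y, ℓ y ≤ ENNReal.ofReal M)
    {c : ℝ} {B : Set (EuclideanSpace ℝ (Fin d))} (hB : B ⊆ {y | y 0 = c}) (hBm : MeasurableSet B) :
    AEMeasurable (linkCount directedSpanningTree X B) P ∧
    ∫⁻ ω, linkCount directedSpanningTree X B ω ∂P =
      ∫⁻ z, ∫⁻ y, (crossingPairs B).indicator (linkDensity ℓ) (y, y + z) := by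
  have hΛ : ∀ K, Bornology.IsBounded K → (volume.withDensity ℓ) K ≠ ∞ := fun K hK => by
    obtain ⟨r, hr⟩ := hK.subset_ball 0
    refine ((measure_mono hr).trans_lt ?_).ne
    rw [withDensity_apply _ measurableSet_ball]
    refine (setLIntegral_mono measurable_const fun y _ => hM y).trans_lt ?_
    rw [setLIntegral_const]
    exact ENNReal.mul_lt_top ENNReal.ofReal_lt_top measure_ball_lt_top
  have hS := measurableSet_crossingPairs hB hBm
  have hm := (measurable_linkDensity hℓ).indicator hS
  obtain ⟨h1, h2⟩ := lintegral_linkCount hX (withDensity_absolutelyContinuous _ _) hΛ hB hBm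
  refine ⟨h1, ?_⟩
  rw [h2, prod_withDensity hℓ hℓ]
  have hexp : Measurable fun p : EuclideanSpace ℝ (Fin d) × EuclideanSpace ℝ (Fin d) =>
      ENNReal.ofReal (Real.exp (-((volume.withDensity ℓ) (Prod.mk p ⁻¹' nearZone d 0)).toReal)) := by
    have h1 := measurable_measure_prodMk_left (ν := volume.withDensity ℓ)
      (isOpen_nearZone (d := d) 0).measurableSet
    exact (Real.measurable_exp.comp h1.ennreal_toReal.neg).ennreal_ofReal
  rw [setLIntegral_withDensity_eq_setLIntegral_mul _
    (f := fun p => ℓ p.1 * ℓ p.2)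
    ((hℓ.comp measurable_fst).mul (hℓ.comp measurable_snd)) hexp hS]
  change ∫⁻ p in crossingPairs B, linkDensity ℓ p ∂_ = _
  -- The shear (y, z) ↦ (y, y + z) preserves volume, and Tonelli moves the displacement z outside.
  rw [← lintegral_indicator hS, ← (measurePreserving_prod_add volume volume).lintegral_comp hm]
  exact lintegral_prod_symm' _ (hm.comp (measurePreserving_prod_add volume volume).measurable)

lemma lintegral_indicator_crossingPairs {z : EuclideanSpace ℝ (Fin d)} (hz : 0 < z 0) {c : ℝ}
    {B : Set (EuclideanSpace ℝ (Fin d))} (hB : B ⊆ {y | y 0 = c}) (hBm : MeasurableSet B)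
    (F : EuclideanSpace ℝ (Fin d) × EuclideanSpace ℝ (Fin d) → ℝ≥0∞) :
    ∫⁻ y, (crossingPairs B).indicator F (y, y + z) = ∫⁻ y in segmentShadow z B, F (y, y + z) := by
  rw [← lintegral_indicator (measurableSet_segmentShadow hz hB hBm)]
  refine lintegral_congr fun y => ?_
  rw [← mk_preimage_crossingPairs hz]
  rfl

lemma lintegral_indicator_crossingPairs_of_nonpos {z : EuclideanSpace ℝ (Fin d)} (hz : z 0 ≤ 0)
    (B : Set (EuclideanSpace ℝ (Fin d)))
    (F : EuclideanSpace ℝ (Fin d) × EuclideanSpace ℝ (Fin d) → ℝ≥0∞) :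
    ∫⁻ y, (crossingPairs B).indicator F (y, y + z) = 0 := by
  rw [← lintegral_zero]
  refine lintegral_congr fun y => Set.indicator_of_notMem (fun h => ?_) _
  have h1 : y 0 < (y + z) 0 := h.1
  rw [PiLp.add_apply] at h1
  linarith

lemma norm_pos_of_apply_zero_pos {z : EuclideanSpace ℝ (Fin d)} (hz : 0 < z 0) : 0 < ‖z‖ :=
  (abs_pos.2 hz.ne').trans_le (abs_apply_zero_le_norm z)

/-- The links of the directed spanning tree on a homogeneous Poisson process cross hyperplanes with
intensity `crossingIntensity`. -/
theorem hasCrossingIntensity [IsProbabilityMeasure P] {γ : ℝ} (hγ : 0 < γ)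
    (hX : IsPoissonProcess P X (ENNReal.ofReal γ • volume)) :
    HasCrossingIntensity P X directedSpanningTree (crossingIntensity d γ) := by
  intro c B hB hBm
  rw [← withDensity_const] at hX
  obtain ⟨h1, h2⟩ := lintegral_linkCount_withDensity hX measurable_const (fun _ => le_rfl) hB hBm
  refine ⟨h1, ?_⟩
  rw [h2, ofReal_crossingIntensity hγ, ← lintegral_mul_const _ (by fun_prop)]
  refine lintegral_congr fun z => ?_
  rcases lt_or_ge 0 (z 0) with hz | hz
  · rw [lintegral_indicator_crossingPairs hz hB hBm]
    have h3 : ∀ y, linkDensity (fun _ => ENNReal.ofReal γ) (y, y + z) = ENNReal.ofReal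
        (γ ^ 2 * Real.exp (-(γ * (‖z‖ ^ d * unitHalfBallVolume d)))) := fun y => by
      have hz' := norm_pos_of_apply_zero_pos hz
      have hv := unitHalfBallVolume_pos (d := d)
      rw [linkDensity, mk_preimage_nearZone, withDensity_const, Measure.smul_apply,
        dist_eq_norm, add_sub_cancel_left, volume_halfBall y hz', smul_eq_mul,
        ← ENNReal.ofReal_mul hγ.le, ← ENNReal.ofReal_mul hγ.le,
        ENNReal.toReal_ofReal (by positivity), ← ENNReal.ofReal_mul (by positivity), sq]
    simp_rw [h3]
    rw [setLIntegral_const, volume_segmentShadow hz hB hBm, ENNReal.ofReal_mul hz.le]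
    ring
  -- Displacements not pointing right vanish on both sides: `ENNReal.ofReal` cuts off the factor z₀.
  · rw [lintegral_indicator_crossingPairs_of_nonpos hz, ENNReal.ofReal_of_nonpos, zero_mul]
    exact mul_nonpos_of_nonpos_of_nonneg hz (by positivity)

end LinkIntegral
end DirectedNetwork

namespace DirectedNetwork

/-! ### Pointwise bounds on the link density. -/

section Estimates

variable {d : ℕ}

lemma ofReal_mul_volume_le_withDensity {ℓ : EuclideanSpace ℝ (Fin d) → ℝ≥0∞} {a : ℝ}
    {A : Set (EuclideanSpace ℝ (Fin d))} (hA : MeasurableSet A)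
    (h : ∀ v ∈ A, ENNReal.ofReal a ≤ ℓ v) :
    ENNReal.ofReal a * volume A ≤ (volume.withDensity ℓ) A := by
  rw [withDensity_apply _ hA, ← setLIntegral_const]
  exact setLIntegral_mono' hA h

lemma withDensity_le_ofReal_mul_volume {ℓ : EuclideanSpace ℝ (Fin d) → ℝ≥0∞} {b : ℝ}
    {A : Set (EuclideanSpace ℝ (Fin d))} (hA : MeasurableSet A)
    (h : ∀ v ∈ A, ℓ v ≤ ENNReal.ofReal b) :
    (volume.withDensity ℓ) A ≤ ENNReal.ofReal b * volume A := by
  rw [withDensity_apply _ hA, ← setLIntegral_const]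
  exact setLIntegral_mono' hA h

variable [NeZero d]

lemma linkDensity_apply (ℓ : EuclideanSpace ℝ (Fin d) → ℝ≥0∞) (y z : EuclideanSpace ℝ (Fin d)) :
    linkDensity ℓ (y, y + z) = ℓ y * ℓ (y + z) * ENNReal.ofReal
      (Real.exp (-((volume.withDensity ℓ) (halfBall y ‖z‖)).toReal)) := by
  rw [linkDensity, mk_preimage_nearZone, dist_eq_norm, add_sub_cancel_left]

lemma linkDensity_le {ℓ : EuclideanSpace ℝ (Fin d) → ℝ≥0∞} {y z : EuclideanSpace ℝ (Fin d)}
    {b Q : ℝ} (hb : 0 ≤ b) (hy : ℓ y ≤ ENNReal.ofReal b) (hw : ℓ (y + z) ≤ ENNReal.ofReal b)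
    (hfin : (volume.withDensity ℓ) (halfBall y ‖z‖) ≠ ∞)
    (hQ : ENNReal.ofReal Q ≤ (volume.withDensity ℓ) (halfBall y ‖z‖)) :
    linkDensity ℓ (y, y + z) ≤ ENNReal.ofReal (b ^ 2 * Real.exp (-Q)) := by
  rw [linkDensity_apply, ENNReal.ofReal_mul (by positivity), sq, ENNReal.ofReal_mul hb]
  gcongr
  exact (ENNReal.ofReal_le_iff_le_toReal hfin).1 hQ

lemma le_linkDensity {ℓ : EuclideanSpace ℝ (Fin d) → ℝ≥0∞} {y z : EuclideanSpace ℝ (Fin d)}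
    {a Q : ℝ} (ha : 0 ≤ a) (hQ0 : 0 ≤ Q) (hy : ENNReal.ofReal a ≤ ℓ y)
    (hw : ENNReal.ofReal a ≤ ℓ (y + z))
    (hQ : (volume.withDensity ℓ) (halfBall y ‖z‖) ≤ ENNReal.ofReal Q) :
    ENNReal.ofReal (a ^ 2 * Real.exp (-Q)) ≤ linkDensity ℓ (y, y + z) := by
  rw [linkDensity_apply, ENNReal.ofReal_mul (by positivity), sq, ENNReal.ofReal_mul ha]
  gcongr
  exact ENNReal.toReal_le_of_le_ofReal hQ0 hQ

/-- If the intensity function is between `a` and `b` around `y`, the link density is close to the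
one of a homogeneous process. -/
lemma linkDensity_mem_Icc {ℓ : EuclideanSpace ℝ (Fin d) → ℝ≥0∞} {y z : EuclideanSpace ℝ (Fin d)}
    (hz : 0 < z 0) {a b : ℝ} (ha : 0 ≤ a) (hb : 0 ≤ b)
    (h : ∀ v ∈ Metric.closedBall y ‖z‖, ℓ v ∈ Set.Icc (ENNReal.ofReal a) (ENNReal.ofReal b)) :
    linkDensity ℓ (y, y + z) ∈ Set.Icc
      (ENNReal.ofReal (a ^ 2 * Real.exp (-(b * (‖z‖ ^ d * unitHalfBallVolume d)))))
      (ENNReal.ofReal (b ^ 2 * Real.exp (-(a * (‖z‖ ^ d * unitHalfBallVolume d))))) := by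
  have hv := unitHalfBallVolume_pos (d := d)
  have hz' := norm_pos_of_apply_zero_pos hz
  have hmeas := (isOpen_halfBall y ‖z‖).measurableSet
  have hsub : halfBall y ‖z‖ ⊆ Metric.closedBall y ‖z‖ :=
    (halfBall_subset_ball _ _).trans Metric.ball_subset_closedBall
  have hy := h y (Metric.mem_closedBall_self (norm_nonneg z))
  have hw := h (y + z) (by simp)
  have hup := withDensity_le_ofReal_mul_volume (ℓ := ℓ) hmeas fun v hv => (h v (hsub hv)).2
  have hlo := ofReal_mul_volume_le_withDensity (ℓ := ℓ) hmeas fun v hv => (h v (hsub hv)).1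
  rw [volume_halfBall y hz', ← ENNReal.ofReal_mul hb] at hup
  rw [volume_halfBall y hz', ← ENNReal.ofReal_mul ha] at hlo
  exact ⟨le_linkDensity ha (by positivity) hy.1 hw.1 hup,
    linkDensity_le hb hy.2 hw.2 (hup.trans_lt ENNReal.ofReal_lt_top).ne hlo⟩

/-- A link through a point `u` has a half ball near `u` to its right whose radius is proportional
to the length of the link. -/
lemma exists_halfBall_subset {y z u : EuclideanSpace ℝ (Fin d)} (hz : 0 < z 0)
    (hu : u ∈ segment ℝ y (y + z)) {c : ℝ} (hc0 : 0 < c) (hc1 : c ≤ 1) :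
    ∃ p, halfBall p (c * ‖z‖) ⊆ halfBall y ‖z‖ ∧ dist p u ≤ c * ‖z‖ := by
  rw [segment_eq_image'] at hu
  obtain ⟨t, ⟨ht0, ht1⟩, rfl⟩ := hu
  simp only [add_sub_cancel_left]
  have hm0 : 0 ≤ max (t - c) 0 := le_max_right _ _
  have hm1 : max (t - c) 0 + c ≤ 1 := by
    rcases max_cases (t - c) 0 with ⟨h, _⟩ | ⟨h, _⟩ <;> rw [h] <;> linarith
  have hm2 : |max (t - c) 0 - t| ≤ c := by
    rw [abs_le]
    rcases max_cases (t - c) 0 with ⟨h, _⟩ | ⟨h, _⟩ <;> rw [h] <;> constructor <;> linarith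
  -- The centre is reached from u = y + t z by going back along the link by c z, but not beyond y.
  -- The new half ball stays inside because max (t - c) 0 + c ≤ 1.
  refine ⟨y + max (t - c) 0 • z, fun v hv => ⟨?_, ?_⟩, ?_⟩
  · refine lt_of_le_of_lt ?_ hv.1
    rw [PiLp.add_apply, PiLp.smul_apply, smul_eq_mul]
    exact le_add_of_nonneg_right (mul_nonneg hm0 hz.le)
  · calc dist v y ≤ dist v (y + max (t - c) 0 • z) + dist (y + max (t - c) 0 • z) y :=
          dist_triangle _ _ _
      _ < c * ‖z‖ + max (t - c) 0 * ‖z‖ := by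
          refine add_lt_add_of_lt_of_le hv.2 ?_
          rw [dist_eq_norm, add_sub_cancel_left, norm_smul, Real.norm_of_nonneg hm0]
      _ = (max (t - c) 0 + c) * ‖z‖ := by ring
      _ ≤ ‖z‖ := mul_le_of_le_one_left (norm_nonneg z) hm1
  · rw [dist_eq_norm, add_sub_add_left_eq_sub, ← sub_smul, norm_smul, Real.norm_eq_abs]
    gcongr

/-- The endpoints may be far from p₀, where ℓ has no lower bound; only the small half ball near the
crossing point u is used. Its points are within 3r of p₀, as the distances v–p, p–u and u–p₀ are
each at most r. -/
lemma linkDensity_le_of_mem_segment {ℓ : EuclideanSpace ℝ (Fin d) → ℝ≥0∞}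
    {y z u p₀ : EuclideanSpace ℝ (Fin d)} (hz : 0 < z 0) (hu : u ∈ segment ℝ y (y + z))
    {c m M r : ℝ} (hc0 : 0 < c) (hc1 : c ≤ 1) (hm : 0 ≤ m) (hM0 : 0 ≤ M)
    (hM : ∀ v, ℓ v ≤ ENNReal.ofReal M)
    (hmr : ∀ v ∈ Metric.ball p₀ (3 * r), ENNReal.ofReal m ≤ ℓ v) (hup : dist u p₀ < r)
    (hcz : c * ‖z‖ ≤ r) :
    linkDensity ℓ (y, y + z) ≤ ENNReal.ofReal
      (M ^ 2 * Real.exp (-(m * c ^ d * unitHalfBallVolume d * ‖z‖ ^ d))) := by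
  have hz' := norm_pos_of_apply_zero_pos hz
  obtain ⟨p, hp, hpu⟩ := exists_halfBall_subset hz hu hc0 hc1
  refine linkDensity_le hM0 (hM y) (hM _) ?_ ?_
  · refine ((withDensity_le_ofReal_mul_volume (isOpen_halfBall y ‖z‖).measurableSet
      fun v _ => hM v).trans_lt ?_).ne
    exact ENNReal.mul_lt_top ENNReal.ofReal_lt_top (volume_halfBall_ne_top _ _).lt_top
  · have h1 := ofReal_mul_volume_le_withDensity (ℓ := ℓ) (a := m)
      (isOpen_halfBall p (c * ‖z‖)).measurableSet fun v hv => hmr v <| by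
        rw [Metric.mem_ball]
        have h2 := hv.2
        have h3 := dist_triangle v p p₀
        have h4 := dist_triangle p u p₀
        linarith
    rw [volume_halfBall p (mul_pos hc0 hz'), ← ENNReal.ofReal_mul hm] at h1
    refine le_trans (ENNReal.ofReal_le_ofReal (le_of_eq ?_)) (h1.trans (measure_mono hp))
    rw [mul_pow]
    ring

end Estimates

/-! ### The scaled intensity functions and the powers s^ξ. -/

section Scaling

variable {d : ℕ}

/-- The intensity function `lam` on `D`, extended by zero and scaled by `s`. -/
noncomputable def scaledDensity (D : Set (EuclideanSpace ℝ (Fin d)))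
    (lam : EuclideanSpace ℝ (Fin d) → ℝ) (s : ℝ) (y : EuclideanSpace ℝ (Fin d)) : ℝ≥0∞ :=
  D.indicator (fun v => ENNReal.ofReal (lam v)) (s⁻¹ • y)

lemma scaledIntensity_eq_withDensity {D : Set (EuclideanSpace ℝ (Fin d))} (hD : IsOpen D)
    (lam : EuclideanSpace ℝ (Fin d) → ℝ) {s : ℝ} (hs : 0 < s) :
    scaledIntensity D lam s = volume.withDensity (scaledDensity D lam s) := by
  rw [scaledIntensity, ← withDensity_indicator (hD.smul₀ hs.ne').measurableSet]
  congr 1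
  ext y
  by_cases h : s⁻¹ • y ∈ D
  · rw [Set.indicator_of_mem ((Set.mem_smul_set_iff_inv_smul_mem₀ hs.ne' D y).2 h), scaledDensity,
      Set.indicator_of_mem h]
  · rw [Set.indicator_of_notMem (mt (Set.mem_smul_set_iff_inv_smul_mem₀ hs.ne' D y).1 h),
      scaledDensity, Set.indicator_of_notMem h]

lemma measurable_scaledDensity {D : Set (EuclideanSpace ℝ (Fin d))} (hD : IsOpen D)
    {lam : EuclideanSpace ℝ (Fin d) → ℝ} (hlam : ContinuousOn lam D) (s : ℝ) :
    Measurable (scaledDensity D lam s) := by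
  classical
  have h1 : Measurable (D.indicator fun v => ENNReal.ofReal (lam v)) := by
    rw [← Set.piecewise_eq_indicator]
    exact (ENNReal.continuous_ofReal.comp_continuousOn hlam).measurable_piecewise
      continuousOn_const hD.measurableSet
  exact h1.comp (measurable_const_smul s⁻¹)

lemma scaledDensity_le {D : Set (EuclideanSpace ℝ (Fin d))}
    {lam : EuclideanSpace ℝ (Fin d) → ℝ} {M : ℝ} (hM : ∀ x ∈ D, lam x ≤ M) (s : ℝ)
    (y : EuclideanSpace ℝ (Fin d)) : scaledDensity D lam s y ≤ ENNReal.ofReal M := by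
  rw [scaledDensity]
  by_cases h : s⁻¹ • y ∈ D
  · rw [Set.indicator_of_mem h]
    exact ENNReal.ofReal_le_ofReal (hM _ h)
  · rw [Set.indicator_of_notMem h]
    exact zero_le

lemma scaledDensity_mem_Icc {D : Set (EuclideanSpace ℝ (Fin d))}
    {lam : EuclideanSpace ℝ (Fin d) → ℝ} {x : EuclideanSpace ℝ (Fin d)} {δ a b : ℝ}
    (hD : Metric.ball x δ ⊆ D) (hab : ∀ v ∈ Metric.ball x δ, lam v ∈ Set.Icc a b) {s : ℝ}
    (hs : 0 < s) {y : EuclideanSpace ℝ (Fin d)} (hy : dist y (s • x) < s * δ) :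
    scaledDensity D lam s y ∈ Set.Icc (ENNReal.ofReal a) (ENNReal.ofReal b) := by
  have hmem : s⁻¹ • y ∈ Metric.ball x δ := by
    have h1 : s⁻¹ • y - x = s⁻¹ • (y - s • x) := by
      rw [smul_sub, inv_smul_smul₀ hs.ne']
    rw [Metric.mem_ball, dist_eq_norm, h1, norm_smul, norm_inv, Real.norm_of_nonneg hs.le,
      inv_mul_lt_iff₀ hs, ← dist_eq_norm]
    exact hy
  rw [scaledDensity, Set.indicator_of_mem (hD hmem)]
  exact ⟨ENNReal.ofReal_le_ofReal (hab _ hmem).1, ENNReal.ofReal_le_ofReal (hab _ hmem).2⟩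

/-- Both endpoints must lie in sD. This caps ‖z‖ by a multiple of s, so a single fraction c serves
for all links in the domination. -/
lemma linkDensity_scaledDensity_eq_zero [NeZero d] {D : Set (EuclideanSpace ℝ (Fin d))}
    {lam : EuclideanSpace ℝ (Fin d) → ℝ} {R : ℝ} (hR : ∀ y ∈ D, ∀ w ∈ D, dist y w ≤ R) {s : ℝ}
    (hs : 0 < s) {y z : EuclideanSpace ℝ (Fin d)} (hz : s * R < ‖z‖) :
    linkDensity (scaledDensity D lam s) (y, y + z) = 0 := by
  have h : s⁻¹ • y ∉ D ∨ s⁻¹ • (y + z) ∉ D := by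
    by_contra! hcon
    have h1 := hR _ hcon.2 _ hcon.1
    rw [dist_eq_norm, ← smul_sub, add_sub_cancel_left, norm_smul, norm_inv,
      Real.norm_of_nonneg hs.le, inv_mul_le_iff₀ hs] at h1
    linarith
  rw [linkDensity_apply, scaledDensity, scaledDensity]
  rcases h with h | h
  · rw [Set.indicator_of_notMem h, zero_mul, zero_mul]
  · rw [Set.indicator_of_notMem h, mul_zero, zero_mul]

lemma exists_ball_lam_mem_Icc {D : Set (EuclideanSpace ℝ (Fin d))} (hD : IsOpen D)
    {lam : EuclideanSpace ℝ (Fin d) → ℝ} (hlam : ContinuousOn lam D)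
    {x : EuclideanSpace ℝ (Fin d)} (hx : x ∈ D) {η : ℝ} (hη : 0 < η) :
    ∃ δ > 0, Metric.ball x δ ⊆ D ∧
      ∀ v ∈ Metric.ball x δ, lam v ∈ Set.Icc (lam x - η) (lam x + η) := by
  have h1 : lam ⁻¹' Set.Icc (lam x - η) (lam x + η) ∈ 𝓝 x :=
    (hlam.continuousAt (hD.mem_nhds hx)).preimage_mem_nhds
      (Icc_mem_nhds (by linarith) (by linarith))
  obtain ⟨δ, hδ, h⟩ := Metric.mem_nhds_iff.1 (inter_mem (hD.mem_nhds hx) h1)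
  exact ⟨δ, hδ, fun v hv => (h hv).1, fun v hv => (h hv).2⟩

lemma eventually_rpow_add_lt {ξ : ℝ} (hξ : ξ < 1) (C : ℝ) {δ : ℝ} (hδ : 0 < δ) :
    ∀ᶠ s : ℝ in atTop, s ^ ξ + C < s * δ := by
  have h1 : Tendsto (fun s : ℝ => s ^ (ξ - 1)) atTop (𝓝 0) := by
    simpa using tendsto_rpow_neg_atTop (sub_pos.2 hξ)
  have h2 := h1.eventually_lt_const (half_pos hδ)
  filter_upwards [h2, eventually_gt_atTop (max 1 (2 * C / δ))] with s hs1 hs2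
  have hs0 : 0 < s := one_pos.trans ((le_max_left _ _).trans_lt hs2)
  have h3 : 2 * C / δ < s := (le_max_right _ _).trans_lt hs2
  rw [div_lt_iff₀ hδ] at h3
  rw [Real.rpow_sub_one hs0.ne', div_lt_iff₀ hs0] at hs1
  linarith

lemma isFluctuationFunction_rpow {ξ : ℝ} (h0 : 0 < ξ) (h1 : ξ < 1) :
    IsFluctuationFunction fun s : ℝ => s ^ ξ where
  one_le s hs := Real.one_le_rpow hs h0.le
  increasing s hs t _ hst := Real.rpow_lt_rpow (zero_le_one.trans hs) hst h0
  unbounded := tendsto_rpow_atTop h0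
  ratio_antitone s hs t ht hst := by
    have hs0 : (0 : ℝ) < s := one_pos.trans_le hs
    have ht0 : (0 : ℝ) < t := one_pos.trans_le ht
    simp only
    rw [← Real.rpow_sub_one hs0.ne', ← Real.rpow_sub_one ht0.ne']
    exact Real.rpow_le_rpow_of_nonpos hs0 hst (by linarith)
  ratio_tendsto := by
    have := tendsto_rpow_neg_atTop (sub_pos.2 h1)
    refine this.congr' ?_
    filter_upwards [eventually_gt_atTop 0] with s hs
    rw [neg_sub, Real.rpow_sub_one hs.ne']

/-- The bracket holds eventually for each fixed η; letting η ↓ 0 afterwards closes it. -/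
lemma tendsto_of_forall_eventually_mem_Icc {ι : Type*} {l : Filter ι} {f : ι → ℝ≥0∞}
    {lo hi : ℝ → ℝ} (hlo : ContinuousAt lo 0) (hhi : ContinuousAt hi 0) (heq : lo 0 = hi 0)
    {γ : ℝ} (hγ : 0 < γ) (h : ∀ η, 0 < η → η < γ →
      ∀ᶠ s in l, f s ∈ Set.Icc (ENNReal.ofReal (lo η)) (ENNReal.ofReal (hi η))) :
    Tendsto f l (𝓝 (ENNReal.ofReal (lo 0))) := by
  have hev : ∀ᶠ η : ℝ in 𝓝[>] 0, η ∈ Set.Ioo 0 γ := Ioo_mem_nhdsGT hγ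
  have h1 : Tendsto (fun η => ENNReal.ofReal (lo η)) (𝓝[>] 0) (𝓝 (ENNReal.ofReal (lo 0))) :=
    (ENNReal.tendsto_ofReal hlo).mono_left nhdsWithin_le_nhds
  have h2 : Tendsto (fun η => ENNReal.ofReal (hi η)) (𝓝[>] 0) (𝓝 (ENNReal.ofReal (lo 0))) := by
    rw [heq]
    exact (ENNReal.tendsto_ofReal hhi).mono_left nhdsWithin_le_nhds
  refine tendsto_order.2 ⟨fun a ha => ?_, fun a ha => ?_⟩
  · obtain ⟨η, hη1, hη2⟩ := ((h1.eventually_const_lt ha).and hev).exists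
    filter_upwards [h η hη2.1 hη2.2] with s hs
    exact hη1.trans_le hs.1
  · obtain ⟨η, hη1, hη2⟩ := ((h2.eventually_lt_const ha).and hev).exists
    filter_upwards [h η hη2.1 hη2.2] with s hs
    exact hs.2.trans_lt hη1

end Scaling

/-! ### Convergence and domination for each displacement, and the limit. -/

section Limit

variable {d : ℕ} [NeZero d]

/-- The contribution of the links with displacement `z` to the expected number of links through the
hyperplane ball of radius `r` around `p`, per unit of hyperplane area. -/
noncomputable def displacementDensity (ℓ : EuclideanSpace ℝ (Fin d) → ℝ≥0∞)
    (p : EuclideanSpace ℝ (Fin d)) (r : ℝ) (z : EuclideanSpace ℝ (Fin d)) : ℝ≥0∞ :=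
  (μHE[d - 1] (hyperplaneBall p r))⁻¹ *
    ∫⁻ y, (crossingPairs (hyperplaneBall p r)).indicator (linkDensity ℓ) (y, y + z)

lemma measurable_displacementDensity {ℓ : EuclideanSpace ℝ (Fin d) → ℝ≥0∞} (hℓ : Measurable ℓ)
    (p : EuclideanSpace ℝ (Fin d)) (r : ℝ) : Measurable (displacementDensity ℓ p r) := by
  have hm := (measurable_linkDensity hℓ).indicator
    (measurableSet_crossingPairs (hyperplaneBall_subset p r) (measurableSet_hyperplaneBall p r))
  exact (hm.comp (measurable_fst.prodMk
    (measurable_fst.add measurable_snd))).lintegral_prod_left'.const_mul _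

lemma displacementDensity_of_nonpos (ℓ : EuclideanSpace ℝ (Fin d) → ℝ≥0∞)
    (p : EuclideanSpace ℝ (Fin d)) (r : ℝ) {z : EuclideanSpace ℝ (Fin d)} (hz : z 0 ≤ 0) :
    displacementDensity ℓ p r z = 0 := by
  rw [displacementDensity, lintegral_indicator_crossingPairs_of_nonpos hz, mul_zero]

lemma displacementDensity_le (ℓ : EuclideanSpace ℝ (Fin d) → ℝ≥0∞)
    (p : EuclideanSpace ℝ (Fin d)) {r : ℝ} (hr : 0 < r) {z : EuclideanSpace ℝ (Fin d)}
    (hz : 0 < z 0) {b : ℝ}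
    (h : ∀ y ∈ segmentShadow z (hyperplaneBall p r), linkDensity ℓ (y, y + z) ≤ ENNReal.ofReal b) :
    displacementDensity ℓ p r z ≤ ENNReal.ofReal (z 0 * b) := by
  obtain ⟨h0, htop⟩ := euclideanHausdorffMeasure_hyperplaneBall p hr
  have hB := hyperplaneBall_subset p r
  have hBm := measurableSet_hyperplaneBall p r
  rw [displacementDensity, lintegral_indicator_crossingPairs hz hB hBm, ENNReal.ofReal_mul hz.le]
  calc _ ≤ (μHE[d - 1] (hyperplaneBall p r))⁻¹ *
        (ENNReal.ofReal b * (ENNReal.ofReal (z 0) * μHE[d - 1] (hyperplaneBall p r))) := by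
        gcongr
        rw [← volume_segmentShadow hz hB hBm, ← setLIntegral_const]
        exact setLIntegral_mono' (measurableSet_segmentShadow hz hB hBm) h
    _ = (μHE[d - 1] (hyperplaneBall p r))⁻¹ * μHE[d - 1] (hyperplaneBall p r) *
        (ENNReal.ofReal (z 0) * ENNReal.ofReal b) := by ring
    _ = _ := by rw [ENNReal.inv_mul_cancel h0 htop, one_mul]

lemma le_displacementDensity (ℓ : EuclideanSpace ℝ (Fin d) → ℝ≥0∞)
    (p : EuclideanSpace ℝ (Fin d)) {r : ℝ} (hr : 0 < r) {z : EuclideanSpace ℝ (Fin d)}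
    (hz : 0 < z 0) {a : ℝ}
    (h : ∀ y ∈ segmentShadow z (hyperplaneBall p r), ENNReal.ofReal a ≤ linkDensity ℓ (y, y + z)) :
    ENNReal.ofReal (z 0 * a) ≤ displacementDensity ℓ p r z := by
  obtain ⟨h0, htop⟩ := euclideanHausdorffMeasure_hyperplaneBall p hr
  have hB := hyperplaneBall_subset p r
  have hBm := measurableSet_hyperplaneBall p r
  rw [displacementDensity, lintegral_indicator_crossingPairs hz hB hBm, ENNReal.ofReal_mul hz.le]
  calc _ = (μHE[d - 1] (hyperplaneBall p r))⁻¹ * μHE[d - 1] (hyperplaneBall p r) *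
        (ENNReal.ofReal (z 0) * ENNReal.ofReal a) := by
        rw [ENNReal.inv_mul_cancel h0 htop, one_mul]
    _ = (μHE[d - 1] (hyperplaneBall p r))⁻¹ *
        (ENNReal.ofReal a * (ENNReal.ofReal (z 0) * μHE[d - 1] (hyperplaneBall p r))) := by ring
    _ ≤ _ := by
        gcongr
        rw [← volume_segmentShadow hz hB hBm, ← setLIntegral_const]
        exact setLIntegral_mono' (measurableSet_segmentShadow hz hB hBm) h

lemma dist_lt_of_mem_segmentShadow {p y v z : EuclideanSpace ℝ (Fin d)} {r : ℝ}
    (hy : y ∈ segmentShadow z (hyperplaneBall p r)) (hv : v ∈ Metric.closedBall y ‖z‖) :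
    dist v p < r + 2 * ‖z‖ := by
  obtain ⟨u, hu, hup⟩ := hy
  have h1 : dist u p < r := hup.1
  have h2 : dist y u ≤ ‖z‖ := by
    rw [segment_eq_image'] at hu
    obtain ⟨t, ht, rfl⟩ := hu
    simp only [add_sub_cancel_left, dist_self_add_right, norm_smul, Real.norm_of_nonneg ht.1]
    exact mul_le_of_le_one_left (norm_nonneg z) ht.2
  have h3 : dist v y ≤ ‖z‖ := hv
  have h4 := dist_triangle v y p
  have h5 := dist_triangle y u p
  linarith

variable {D : Set (EuclideanSpace ℝ (Fin d))} {lam : EuclideanSpace ℝ (Fin d) → ℝ}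
  {x : EuclideanSpace ℝ (Fin d)}

/-- For fixed z, every half ball that matters lies within s^ξ + 2‖z‖ < sδ of sx, where the intensity
is λ(x) up to η. The link density is then squeezed between two homogeneous ones and the prism volume
supplies the factor z₀. -/
lemma tendsto_displacementDensity (hD : IsOpen D) (hlam : ContinuousOn lam D) (hx : x ∈ D)
    (hpos : 0 < lam x) {ξ : ℝ} (hξ : ξ < 1) (z : EuclideanSpace ℝ (Fin d)) :
    Tendsto (fun s : ℝ => displacementDensity (scaledDensity D lam s) (s • x) (s ^ ξ) z) atTop
      (𝓝 (ENNReal.ofReal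
        (z 0 * (lam x ^ 2 * Real.exp (-(lam x * (‖z‖ ^ d * unitHalfBallVolume d))))))) := by
  rcases lt_or_ge 0 (z 0) with hz | hz
  · set q := ‖z‖ ^ d * unitHalfBallVolume d with hq
    have h := tendsto_of_forall_eventually_mem_Icc (l := atTop)
      (f := fun s : ℝ => displacementDensity (scaledDensity D lam s) (s • x) (s ^ ξ) z)
      (lo := fun η => z 0 * ((lam x - η) ^ 2 * Real.exp (-((lam x + η) * q))))
      (hi := fun η => z 0 * ((lam x + η) ^ 2 * Real.exp (-((lam x - η) * q))))
      (by fun_prop) (by fun_prop) (by simp) hpos ?_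
    · simpa using h
    intro η hη hηl
    obtain ⟨δ, hδ, hball, hIcc⟩ := exists_ball_lam_mem_Icc hD hlam hx hη
    filter_upwards [eventually_rpow_add_lt hξ (2 * ‖z‖) hδ, eventually_gt_atTop 0] with s hs hs0
    have hmem : ∀ y ∈ segmentShadow z (hyperplaneBall (s • x) (s ^ ξ)), _ := fun y hy =>
      linkDensity_mem_Icc (ℓ := scaledDensity D lam s) (y := y) hz (a := lam x - η)
        (b := lam x + η) (by linarith) (by linarith) fun v hv =>
          scaledDensity_mem_Icc hball hIcc hs0 ((dist_lt_of_mem_segmentShadow hy hv).trans hs)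
    exact ⟨le_displacementDensity _ _ (Real.rpow_pos_of_pos hs0 ξ) hz fun y hy => (hmem y hy).1,
      displacementDensity_le _ _ (Real.rpow_pos_of_pos hs0 ξ) hz fun y hy => (hmem y hy).2⟩
  · simp_rw [displacementDensity_of_nonpos _ _ _ hz]
    rw [ENNReal.ofReal_of_nonpos (mul_nonpos_of_nonpos_of_nonneg hz (by positivity))]
    exact tendsto_const_nhds

/-- The bound holds for all z at once from some s on, with an exponent independent of s; this is
what dominated convergence needs. -/
lemma exists_displacementDensity_le (hD : IsOpen D) (hDb : Bornology.IsBounded D)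
    (hlam : ContinuousOn lam D) {M : ℝ} (hM : ∀ x ∈ D, lam x ≤ M) (hx : x ∈ D)
    (hpos : 0 < lam x) {ξ : ℝ} (hξ : ξ < 1) :
    ∃ a > 0, ∀ᶠ s : ℝ in atTop, ∀ z : EuclideanSpace ℝ (Fin d),
      displacementDensity (scaledDensity D lam s) (s • x) (s ^ ξ) z ≤
        ENNReal.ofReal (M ^ 2) * ENNReal.ofReal (‖z‖ * Real.exp (-(a * ‖z‖ ^ d))) := by
  have hM0 : 0 ≤ M := hpos.le.trans (hM x hx)
  obtain ⟨δ, hδ, hball, hIcc⟩ := exists_ball_lam_mem_Icc hD hlam hx (half_pos hpos)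
  obtain ⟨R, hR⟩ := Metric.isBounded_iff.1 hDb
  have hR0 : 0 < max R 1 := one_pos.trans_le (le_max_right _ _)
  -- Links have length at most s · max R 1, so this c gives c‖z‖ ≤ sδ/3, a third of the radius on
  -- which λ ≥ λ(x)/2. The maximum with 1 keeps the denominator positive.
  set c : ℝ := min 1 (δ / 3 / max R 1) with hc
  have hc0 : 0 < c := lt_min one_pos (by positivity)
  have hc1 : c ≤ 1 := min_le_left _ _
  have hcR : c * max R 1 ≤ δ / 3 := by
    rw [← le_div_iff₀ hR0]
    exact min_le_right _ _
  have hv := unitHalfBallVolume_pos (d := d)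
  refine ⟨lam x / 2 * c ^ d * unitHalfBallVolume d, by positivity, ?_⟩
  filter_upwards [eventually_rpow_add_lt hξ 0 (by positivity : 0 < δ / 3),
    eventually_gt_atTop 0] with s hs hs0 z
  rw [add_zero] at hs
  rcases lt_or_ge 0 (z 0) with hz | hz
  · refine (displacementDensity_le _ _ (Real.rpow_pos_of_pos hs0 ξ) hz (b := M ^ 2 * Real.exp
      (-(lam x / 2 * c ^ d * unitHalfBallVolume d * ‖z‖ ^ d))) fun y hy => ?_).trans ?_
    · rcases lt_or_ge (s * max R 1) ‖z‖ with hzR | hzR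
      · rw [linkDensity_scaledDensity_eq_zero
          (fun y hy w hw => (hR hy hw).trans (le_max_left R 1)) hs0 hzR]
        exact zero_le
      · obtain ⟨u, hu, hup⟩ := hy
        refine linkDensity_le_of_mem_segment hz hu (p₀ := s • x) (r := s * (δ / 3)) hc0 hc1
          (half_pos hpos).le hM0 (scaledDensity_le hM s) (fun v hv => ?_)
          (lt_trans (Metric.mem_ball.1 hup.1) hs) ?_
        · have := (scaledDensity_mem_Icc hball hIcc hs0 (y := v) (by
            rw [Metric.mem_ball] at hv
            linarith)).1
          rwa [sub_half] at this
        · calc c * ‖z‖ ≤ c * (s * max R 1) := by gcongr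
            _ = s * (c * max R 1) := by ring
            _ ≤ s * (δ / 3) := by gcongr
    · rw [← ENNReal.ofReal_mul (by positivity), mul_left_comm]
      refine ENNReal.ofReal_le_ofReal ?_
      gcongr
      exact (le_abs_self _).trans (abs_apply_zero_le_norm z)
  · rw [displacementDensity_of_nonpos _ _ _ hz]
    exact zero_le

theorem tendsto_lintegral_displacementDensity (hD : IsOpen D) (hDb : Bornology.IsBounded D)
    (hlam : ContinuousOn lam D) {M : ℝ} (hM : ∀ x ∈ D, lam x ≤ M) (hx : x ∈ D)
    (hpos : 0 < lam x) {ξ : ℝ} (hξ : ξ < 1) :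
    Tendsto (fun s : ℝ => ∫⁻ z, displacementDensity (scaledDensity D lam s) (s • x) (s ^ ξ) z) atTop
      (𝓝 (ENNReal.ofReal (crossingIntensity d (lam x)))) := by
  obtain ⟨a, ha, hbound⟩ := exists_displacementDensity_le hD hDb hlam hM hx hpos hξ
  rw [ofReal_crossingIntensity hpos]
  refine tendsto_lintegral_filter_of_dominated_convergence
    (fun z => ENNReal.ofReal (M ^ 2) * ENNReal.ofReal (‖z‖ * Real.exp (-(a * ‖z‖ ^ d))))
    (Eventually.of_forall fun s =>
      measurable_displacementDensity (measurable_scaledDensity hD hlam s) _ _)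
    (hbound.mono fun s hs => Eventually.of_forall hs) ?_
    (Eventually.of_forall fun z => tendsto_displacementDensity hD hlam hx hpos hξ z)
  rw [lintegral_const_mul _ (by fun_prop)]
  exact (ENNReal.mul_lt_top ENNReal.ofReal_lt_top (lintegral_norm_mul_exp_lt_top ha)).ne

end Limit
end DirectedNetwork

/-! ### Assembly of the theorem. -/

theorem proposition3 {d : ℕ} [NeZero d]
    (D : Set (EuclideanSpace ℝ (Fin d))) (hD_open : IsOpen D)
    (hD_bdd : Bornology.IsBounded D) (hD_convex : Convex ℝ D)
    (lam : EuclideanSpace ℝ (Fin d) → ℝ) (hlam_pos : ∀ x ∈ D, 0 < lam x)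
    (hlam_bdd : ∃ M : ℝ, ∀ x ∈ D, lam x ≤ M) (hlam_lip : LocallyLipschitzOn D lam)
    {Ω : Type*} [MeasurableSpace Ω] (P : Measure Ω) [IsProbabilityMeasure P]
    (X : ℝ → Ω → Set (EuclideanSpace ℝ (Fin d)))
    (hX : ∀ s : ℝ, 1 ≤ s →
      DirectedNetwork.IsPoissonProcess P (X s) (DirectedNetwork.scaledIntensity D lam s)) :
    ∃ lamA : EuclideanSpace ℝ (Fin d) → ℝ,
      (∀ ξ : ℝ, 0 < ξ → ξ < 1 →
        DirectedNetwork.IsFluctuationFunction (fun s : ℝ => s ^ ξ) ∧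
        DirectedNetwork.IsLinkDensity P D X DirectedNetwork.directedSpanningTree
          (fun s : ℝ => s ^ ξ) lamA) ∧
      (∀ x ∈ D, ∀ {Ω' : Type*} [MeasurableSpace Ω'] (P' : Measure Ω') [IsProbabilityMeasure P']
        (Y : Ω' → Set (EuclideanSpace ℝ (Fin d))),
        DirectedNetwork.IsPoissonProcess P' Y (ENNReal.ofReal (lam x) • volume) →
        DirectedNetwork.HasCrossingIntensity P' Y DirectedNetwork.directedSpanningTree
          (lamA x)) := by
  obtain ⟨M, hM⟩ := hlam_bdd
  have hlam : ContinuousOn lam D := hlam_lip.continuousOn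
  have hcount : ∀ (x : EuclideanSpace ℝ (Fin d)) (ξ s : ℝ), 1 ≤ s → _ := fun x ξ s hs =>
    DirectedNetwork.lintegral_linkCount_withDensity
      (DirectedNetwork.scaledIntensity_eq_withDensity hD_open lam (one_pos.trans_le hs) ▸ hX s hs)
      (DirectedNetwork.measurable_scaledDensity hD_open hlam s)
      (DirectedNetwork.scaledDensity_le hM s)
      (DirectedNetwork.hyperplaneBall_subset (s • x) (s ^ ξ))
      (DirectedNetwork.measurableSet_hyperplaneBall (s • x) (s ^ ξ))
  -- The density depends on x only through λ(x), and the same function serves every ξ.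
  refine ⟨fun x => DirectedNetwork.crossingIntensity d (lam x), fun ξ h0 h1 =>
    ⟨DirectedNetwork.isFluctuationFunction_rpow h0 h1,
      fun x hx => DirectedNetwork.crossingIntensity_pos (hlam_pos x hx),
      fun x _ s hs => (hcount x ξ s hs).1, fun x hx => ?_⟩,
    fun x hx _ _ _ _ _ hY => DirectedNetwork.hasCrossingIntensity (hlam_pos x hx) hY⟩
  refine (DirectedNetwork.tendsto_lintegral_displacementDensity hD_open hD_bdd hlam hM hx
    (hlam_pos x hx) h1).congr' ?_
  filter_upwards [eventually_ge_atTop 1] with s hs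
  rw [(hcount x ξ s hs).2]
  simp_rw [DirectedNetwork.displacementDensity]
  have h2 := (DirectedNetwork.euclideanHausdorffMeasure_hyperplaneBall (s • x)
    (Real.rpow_pos_of_pos (one_pos.trans_le hs) ξ)).1
  exact lintegral_const_mul' _ _ (ENNReal.inv_ne_top.2 h2)
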